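/- Let $K$ be a field and $S=K[x_1,\dots,x_n]$. A monomial ideal $I\subset S$ is of *Borel type* if $(I:x_j^\infty)=(I:(x_1,\dots,x_j)^\infty)$ for all $1\le j\le n$. For a nonzero $\mathbb Z^n$-graded $S$-module $M$, a *Stanley decomposition* of $M$ is a finite direct sum decomposition $\mathcal D: M=\bigoplus_{i=1}^r u_iK[Z_i]$ as a $K$-vector space, where each $u_i\in M$ is homogeneous, $Z_i\subset\{x_1,\dots,x_n\}$, and $u_iK[Z_i]$ is a free $K[Z_i]$-module with basis $u_i$; $\operatorname{sdepth}(\mathcal D)=\min_i|Z_i|$, and the *Stanley depth* $\operatorname{sdepth}(M)$ is the maximum of $\operatorname{sdepth}(\mathcal D)$ over all Stanley decompositions $\mathcal D$ of $M$. The depth of $M$ is the maximal length of an $M$-regular sequence in $(x_1,\dots,x_n)$. Let $I\subset S$ be a monomial ideal of Borel type with $\operatorname{Ass}(S/I)=\{P_0,\dots,P_m\}$, where $P_i=(x_1,\dots,x_{n_i})$ and $n\ge n_0>n_1>\cdots>n_m\ge 1$. Let $I=\bigcap_{i=0}^m Q_i$ be a reduced primary decomposition of $I$ with $\sqrt{Q_i}=P_i$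 for $0\le i\le m$, and put $I_k=\bigcap_{j=k}^m Q_j$ for $0\le k\le m$, so that $I=I_0\subset I_1\subset\cdots\subset I_m$ (the sequential chain of $I$). Then: (1) $\operatorname{sdepth}(S/I_i)=\operatorname{depth}(S/I_i)=n-n_i$ for all $0\le i\le m$. (2) $\operatorname{sdepth}(I_0)\le\operatorname{sdepth}(I_1)\le\cdots\le\operatorname{sdepth}(I_m)$. (3) $\operatorname{depth}(I_i)=n-n_i+1\le\operatorname{sdepth}(I_i)\le\operatorname{sdepth}(P_i)=n-\left\lfloor\frac{n_i}{2}\right\rfloor$ for all $0\le i\le m$. -/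

import Mathlib

open MvPolynomial

noncomputable section

section Monomial

variable {K : Type*} [Field K] {n : ℕ}

/-- A monomial ideal of `K[x_1, …, x_n]`: an ideal generated by monomials. -/
def IsMonomialIdeal (I : Ideal (MvPolynomial (Fin n) K)) : Prop :=
  ∃ A : Set (Fin n →₀ ℕ), I = Ideal.span ((fun d => monomial d (1 : K)) '' A)

/-- The ideal `(x_1, …, x_k)` of `K[x_1, …, x_n]`, for `k ≤ n`. The variable `x_j` of the
mathematical text is `X ⟨j - 1, _⟩`. -/
def initialVarIdeal (K : Type*) [Field K] (n k : ℕ) : Ideal (MvPolynomial (Fin n) K) :=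
  Ideal.span (X '' {j : Fin n | (j : ℕ) < k})

/-- `(I : J^∞)`, the union of the ascending chain of the ideals `(I : J^k)`. -/
def colonInfty {R : Type*} [CommRing R] (I J : Ideal R) : Ideal R :=
  ⨆ k : ℕ, Submodule.colon I ((J ^ k : Ideal R) : Set R)

/-- A monomial ideal is of Borel type if `(I : x_j^∞) = (I : (x_1, …, x_j)^∞)` for all `j`. -/
def IsBorelType (I : Ideal (MvPolynomial (Fin n) K)) : Prop :=
  IsMonomialIdeal I ∧ ∀ j : Fin n,
    colonInfty I (Ideal.span {X j}) = colonInfty I (initialVarIdeal K n ((j : ℕ) + 1))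

open Classical in
/-- `I = Q_0 ∩ ⋯ ∩ Q_m` is a reduced primary decomposition: the `Q_i` are primary, their radicals
are pairwise distinct, and none of them can be omitted. -/
def IsReducedPrimaryDecomposition {R : Type*} [CommRing R] {m : ℕ} (I : Ideal R)
    (Q : Fin (m + 1) → Ideal R) : Prop :=
  Function.Injective Q ∧ Submodule.IsMinimalPrimaryDecomposition I (Finset.univ.image Q)

/-- The ideals `I_k = Q_k ∩ Q_{k+1} ∩ ⋯ ∩ Q_m`. -/
def tailInter {R : Type*} [CommRing R] {m : ℕ} (Q : Fin (m + 1) → Ideal R) (k : Fin (m + 1)) :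
    Ideal R :=
  ⨅ j : Fin (m + 1), ⨅ _ : k ≤ j, Q j

/-- The component of degree `a ∈ ℤ^n` of `K[x_1, …, x_n]`: it is `K · x^a` if `a ≥ 0`,
and `0` otherwise. -/
def polyPart (K : Type*) [Field K] {n : ℕ} (a : Fin n → ℤ) :
    Submodule K (MvPolynomial (Fin n) K) :=
  restrictSupport K {d : Fin n →₀ ℕ | ∀ j, (d j : ℤ) = a j}

/-- The component of degree `a ∈ ℤ^n` of an ideal `I`. (These components form a grading of `I`
when `I` is a monomial ideal.) -/
def idealPart (I : Ideal (MvPolynomial (Fin n) K)) (a : Fin n → ℤ) : Submodule K I :=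
  (polyPart K a).comap ((Submodule.subtype I).restrictScalars K)

/-- The component of degree `a ∈ ℤ^n` of `S/I`. (These components form a grading of `S/I`
when `I` is a monomial ideal.) -/
def quotPart (I : Ideal (MvPolynomial (Fin n) K)) (a : Fin n → ℤ) :
    Submodule K (MvPolynomial (Fin n) K ⧸ I) :=
  (polyPart K a).map ((Submodule.mkQ I).restrictScalars K)

end Monomial

section Stanley

variable {K : Type*} [Field K] {n : ℕ} {M : Type*} [AddCommGroup M] [Module K M]
  [Module (MvPolynomial (Fin n) K) M] [IsScalarTower K (MvPolynomial (Fin n) K) M]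

/-- The `K`-subspace `u K[Z] = {p u : p ∈ K[Z]}` of an `S`-module. -/
def stanleySpace (u : M) (Z : Finset (Fin n)) : Submodule K M :=
  (Subalgebra.toSubmodule (supported K (Z : Set (Fin n)))).map
    ((LinearMap.toSpanSingleton (MvPolynomial (Fin n) K) M u).restrictScalars K)

/-- A Stanley decomposition `M = ⨁_{i=1}^r u_i K[Z_i]` of an `S`-module `M` with homogeneous
components `ℳ a`, `a ∈ ℤ^n`: each `u_i` is homogeneous and each `u_i K[Z_i]` is a free
`K[Z_i]`-module with basis `u_i`. -/
structure StanleyDecomposition (ℳ : (Fin n → ℤ) → Submodule K M) where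
  r : ℕ
  u : Fin r → M
  Z : Fin r → Finset (Fin n)
  homogeneous : ∀ i, ∃ a, u i ∈ ℳ a
  free : ∀ i, Function.Injective fun p : supported K (Z i : Set (Fin n)) =>
    (p : MvPolynomial (Fin n) K) • u i
  internal : DirectSum.IsInternal fun i => (stanleySpace (u i) (Z i) : Submodule K M)

/-- The Stanley depth `min_i |Z_i|` of a Stanley decomposition. -/
def StanleyDecomposition.sdepth {ℳ : (Fin n → ℤ) → Submodule K M}
    (D : StanleyDecomposition ℳ) : ℕ∞ :=
  ⨅ i, ((D.Z i).card : ℕ∞)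

/-- The Stanley depth of a `ℤ^n`-graded module `M ≠ 0`: the maximum of the Stanley depths of its
Stanley decompositions (all of which are at most `n`). -/
def sdepth (ℳ : (Fin n → ℤ) → Submodule K M) : ℕ∞ :=
  ⨆ D : StanleyDecomposition ℳ, D.sdepth

end Stanley

section Invariants

variable {K : Type*} [Field K] {n : ℕ}

/-- The depth of an `S`-module: the maximal length of an `M`-regular sequence in the graded
maximal ideal `(x_1, …, x_n)`. -/
def polyDepth (K : Type*) [Field K] (n : ℕ) (M : Type*) [AddCommGroup M]
    [Module (MvPolynomial (Fin n) K) M] : ℕ∞ :=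
  ⨆ rs : {rs : List (MvPolynomial (Fin n) K) //
      (∀ f ∈ rs, f ∈ idealOfVars (Fin n) K) ∧ RingTheory.Sequence.IsRegular M rs},
    (rs.1.length : ℕ∞)

/-- The Stanley depth `sdepth(I)` of an ideal `I`, as a `ℤ^n`-graded module. -/
def sdepthIdeal (I : Ideal (MvPolynomial (Fin n) K)) : ℕ∞ := sdepth (idealPart I)

/-- The Stanley depth `sdepth(S/I)`. -/
def sdepthQuot (I : Ideal (MvPolynomial (Fin n) K)) : ℕ∞ := sdepth (quotPart I)

/-- The depth `depth(I)` of an ideal `I`, as a module. -/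
def depthIdeal (I : Ideal (MvPolynomial (Fin n) K)) : ℕ∞ := polyDepth K n I

/-- The depth `depth(S/I)`. -/
def depthQuot (I : Ideal (MvPolynomial (Fin n) K)) : ℕ∞ :=
  polyDepth K n (MvPolynomial (Fin n) K ⧸ I)

end Invariants

end

/-! Fix i, put p = `ν i`, P = (x_1, …, x_p) and J = I_i. Two facts about J carry the proof. The
radicals of the Q_j with j ≥ i only involve x_1, …, x_p, so x_{p+1}, …, x_n are nonzerodivisors
modulo J (`isVarSaturated_tailInter`). Since P is associated to S/I, there is a monomial x^w in x_1,
…, x_p with (J : x^w) = P (`exists_isSocleExponent_tailInter`). Moreover each I_j is the colon of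
any earlier I_i by a power of one variable (`exists_tailInter_eq_colon`), which also shows that all
I_j are monomial.

Stanley depth becomes combinatorial: graded components have dimension at most one, so a Stanley
decomposition is a finite partition of the exponent set into boxes (`le_sdepth_iff`). Truncating
exponents at the lcm of the generators gives boxes with at least n - p directions for S/J and, since
J is closed under multiplication, n - p + 1 for J. The box through w has no direction among the
first p, which bounds sdepth(S/J). Box partitions pull back along multiplication by a monomial, so
colons do not decrease the Stanley depth of ideals: this yields both the monotonicity of the chain
and sdepth(J) ≤ sdepth(P). For P itself the lower bound comes from matchings of an odd cycle, the
upper bound from counting the monomials x_j x_l.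

For depth, x_{p+1}, …, x_n is regular on S/J, and remains so on J with x_1 appended. The classes of
x^w and x_1 x^w are nonzero and killed by all variables in the respective quotients, so these
sequences cannot be extended; `length_le_of_socle` shows through Ext that they are then longest. -/

noncomputable section

/-! ### Partitions of exponent sets into boxes -/

section BoxPartition

variable {n : ℕ}

/-- The exponents of the monomials in `x^c K[Z]`. -/
def exponentBox (c : Fin n →₀ ℕ) (Z : Finset (Fin n)) : Set (Fin n →₀ ℕ) :=
  {d | c ≤ d ∧ ∀ j ∉ Z, d j = c j}

/-- The boxes with corners `c i` and directions `Z i` partition the set `A` of exponents. -/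
structure IsBoxPartition {ι : Type*} (A : Set (Fin n →₀ ℕ)) (c : ι → Fin n →₀ ℕ)
    (Z : ι → Finset (Fin n)) : Prop where
  subset : ∀ i, exponentBox (c i) (Z i) ⊆ A
  existsUnique : ∀ d ∈ A, ∃! i, d ∈ exponentBox (c i) (Z i)

/-- `A` has a finite partition into boxes with at least `k` directions each. -/
def HasBoxPartition (A : Set (Fin n →₀ ℕ)) (k : ℕ) : Prop :=
  ∃ (r : ℕ) (c : Fin r → Fin n →₀ ℕ) (Z : Fin r → Finset (Fin n)),
    IsBoxPartition A c Z ∧ ∀ i, k ≤ (Z i).card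

lemma corner_mem_exponentBox (c : Fin n →₀ ℕ) (Z : Finset (Fin n)) : c ∈ exponentBox c Z :=
  ⟨le_rfl, fun _ _ => rfl⟩

lemma IsBoxPartition.eq_of_mem {ι : Type*} {A : Set (Fin n →₀ ℕ)} {c : ι → Fin n →₀ ℕ}
    {Z : ι → Finset (Fin n)} (h : IsBoxPartition A c Z) {d : Fin n →₀ ℕ} {i j : ι}
    (hi : d ∈ exponentBox (c i) (Z i)) (hj : d ∈ exponentBox (c j) (Z j)) : i = j :=
  (h.existsUnique d (h.subset i hi)).unique hi hj

lemma HasBoxPartition.of_finite {ι : Type*} [Finite ι] {A : Set (Fin n →₀ ℕ)} {k : ℕ}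
    {c : ι → Fin n →₀ ℕ} {Z : ι → Finset (Fin n)} (h : IsBoxPartition A c Z)
    (hk : ∀ i, k ≤ (Z i).card) : HasBoxPartition A k := by
  obtain ⟨r, ⟨e⟩⟩ := Finite.exists_equiv_fin ι
  refine ⟨r, c ∘ e.symm, Z ∘ e.symm, ⟨fun i => h.subset _, fun d hd => ?_⟩, fun i => hk _⟩
  obtain ⟨i, hi, hu⟩ := h.existsUnique d hd
  refine ⟨e i, by simpa using hi, fun j hj => ?_⟩
  rw [← hu _ hj, Equiv.apply_symm_apply]

/-- Translating a box back by u gives either nothing or a box with the same directions; coordinates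
that are not directions decide which. -/
lemma add_mem_exponentBox_iff {c d u : Fin n →₀ ℕ} {Z : Finset (Fin n)} :
    d + u ∈ exponentBox c Z ↔ (∀ j ∉ Z, u j ≤ c j) ∧ d ∈ exponentBox (c - u) Z := by
  simp only [exponentBox, Set.mem_ofPred_eq, Finsupp.le_def, Finsupp.add_apply,
    Finsupp.tsub_apply]
  constructor
  · rintro ⟨h1, h2⟩
    refine ⟨fun j hj => ?_, fun j => ?_, fun j hj => ?_⟩
    · have := h2 j hj; omega
    · have := h1 j; omega
    · have := h2 j hj; omega
  · rintro ⟨h1, h2, h3⟩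
    refine ⟨fun j => ?_, fun j hj => ?_⟩
    · have := h2 j; omega
    · have := h1 j hj; have := h3 j hj; omega

/-- A box partition of the exponents of `I` induces one of the exponents of `I : x^u`. -/
lemma HasBoxPartition.shift {A : Set (Fin n →₀ ℕ)} {k : ℕ} (h : HasBoxPartition A k)
    (u : Fin n →₀ ℕ) : HasBoxPartition {d | d + u ∈ A} k := by
  obtain ⟨r, c, Z, hp, hk⟩ := h
  refine HasBoxPartition.of_finite (ι := {i : Fin r // ∀ j ∉ Z i, u j ≤ c i j})
    (c := fun i => c i - u) (Z := fun i => Z i) ⟨fun i d hd => ?_, fun d hd => ?_⟩ fun i => hk _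
  · exact hp.subset i (add_mem_exponentBox_iff.2 ⟨i.2, hd⟩)
  · obtain ⟨i, hi, hu⟩ := hp.existsUnique _ hd
    have hi' := add_mem_exponentBox_iff.1 hi
    refine ⟨⟨i, hi'.1⟩, hi'.2, fun j hj => Subtype.ext (hu _ ?_)⟩
    exact add_mem_exponentBox_iff.2 ⟨j.2, hj⟩

/-- A set of exponents on which membership only depends on the truncation at `N` is partitioned
into boxes whose directions include all `j` with `N j = 0`. -/
lemma HasBoxPartition.of_trunc {A : Set (Fin n →₀ ℕ)} (N : Fin n →₀ ℕ)
    (hA : ∀ d, d ⊓ N ∈ A ↔ d ∈ A) {k : ℕ}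
    (hk : k ≤ (Finset.univ.filter fun j => N j = 0).card) : HasBoxPartition A k := by
  have : Finite {c : Fin n →₀ ℕ // c ≤ N} := (Set.finite_Iic N).to_subtype
  -- The boxes are the fibres of the truncation d ↦ d ⊓ N: a coordinate is free exactly when it has
  -- reached the cap.
  have key : ∀ c ≤ N, ∀ d, d ∈ exponentBox c (Finset.univ.filter fun j => c j = N j) ↔
      d ⊓ N = c := by
    intro c hc d
    simp only [exponentBox, Set.mem_ofPred_eq, Finsupp.le_def, Finset.mem_filter, Finset.mem_univ,
      true_and, Finsupp.ext_iff, Finsupp.inf_apply, ← forall_and]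
    refine forall_congr' fun j => ?_
    have := hc j
    by_cases h : c j = N j <;> simp [h] <;> omega
  refine HasBoxPartition.of_finite (ι := {c : {c : Fin n →₀ ℕ // c ≤ N} // (c : Fin n →₀ ℕ) ∈ A})
    (c := fun c => c) (Z := fun c => Finset.univ.filter fun j => (c : Fin n →₀ ℕ) j = N j)
    ⟨fun c d hd => ?_, fun d hd => ?_⟩ fun c => ?_
  · rw [key _ c.1.2] at hd
    rw [← hA, hd]
    exact c.2
  · refine ⟨⟨⟨d ⊓ N, inf_le_right⟩, (hA d).2 hd⟩, (key _ inf_le_right d).2 rfl, fun c hc => ?_⟩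
    exact Subtype.ext (Subtype.ext ((key _ c.1.2 d).1 hc).symm)
  · refine hk.trans (Finset.card_le_card fun j hj => ?_)
    have hc : (c : Fin n →₀ ℕ) j ≤ N j := c.1.2 j
    simp only [Finset.mem_filter, Finset.mem_univ, true_and] at hj ⊢
    omega

/-- As `HasBoxPartition.of_trunc`, but for an upper set, with one more direction `z` in each
box. -/
lemma HasBoxPartition.of_trunc_of_isUpperSet {A : Set (Fin n →₀ ℕ)} (N : Fin n →₀ ℕ)
    (hA : ∀ d, d ⊓ N ∈ A ↔ d ∈ A) (hup : IsUpperSet A) (z : Fin n) (hz : N z ≠ 0) {k : ℕ}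
    (hk : k ≤ (Finset.univ.filter fun j => N j = 0).card + 1) : HasBoxPartition A k := by
  have : Finite {c : Fin n →₀ ℕ // c ≤ N} := (Set.finite_Iic N).to_subtype
  -- On each line parallel to z, the points of A below N form a final segment because A is an upper
  -- set. Only the lowest point is kept as a corner, and its box absorbs the rest of the line.
  let ι := {c : {c : Fin n →₀ ℕ // c ≤ N} // (c : Fin n →₀ ℕ) ∈ A ∧
    ∀ t < (c : Fin n →₀ ℕ) z, (c : Fin n →₀ ℕ).update z t ∉ A}
  have key : ∀ c ≤ N, ∀ d,
      d ∈ exponentBox c (insert z (Finset.univ.filter fun j => c j = N j)) ↔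
      (d ⊓ N).update z (c z) = c ∧ c z ≤ d z := by
    intro c hc d
    have h1 : (d ⊓ N).update z (c z) = c ∧ c z ≤ d z ↔
        ∀ j, (j ≠ z → min (d j) (N j) = c j) ∧ (j = z → c z ≤ d z) := by
      rw [forall_and, Finsupp.ext_iff]
      refine and_congr (forall_congr' fun j => ?_) (by simp)
      by_cases h : j = z
      · subst h; simp
      · simp [h]
    rw [h1]
    simp only [exponentBox, Set.mem_ofPred_eq, Finsupp.le_def, Finset.mem_filter, Finset.mem_univ,
      true_and, Finset.mem_insert, ← forall_and]
    refine forall_congr' fun j => ?_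
    have := hc j
    by_cases h' : j = z
    · subst h'; simp
    · by_cases h : c j = N j <;> simp [h, h'] <;> omega
  refine HasBoxPartition.of_finite (ι := ι)
    (c := fun c => c) (Z := fun c => insert z (Finset.univ.filter fun j =>
      (c : Fin n →₀ ℕ) j = N j))
    ⟨fun c d hd => hup hd.1 c.2.1, fun d hd => ?_⟩ fun c => ?_
  · have hex : ∃ t, (d ⊓ N).update z t ∈ A := ⟨(d ⊓ N) z, by
      rw [Finsupp.update_self]; exact (hA d).2 hd⟩
    classical
    have hs := Nat.find_spec hex
    have hle : Nat.find hex ≤ (d ⊓ N) z := Nat.find_min' hex (by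
      rw [Finsupp.update_self]; exact (hA d).2 hd)
    have hcN : (d ⊓ N).update z (Nat.find hex) ≤ N := fun j => by
      by_cases h : j = z
      · subst h; simpa using hle.trans (by simp)
      · simp [Function.update_of_ne h]
    refine ⟨⟨⟨_, hcN⟩, hs, fun t ht => ?_⟩, ?_, fun c hc => ?_⟩
    · simp only [Finsupp.coe_update, Function.update_self] at ht
      have := Nat.find_min hex ht
      simpa using this
    · refine (key _ hcN d).2 ⟨by simp, ?_⟩
      simpa using hle.trans (by simp)
    · replace hc := (key _ c.1.2 d).1 hc
      have h1 : Nat.find hex = (c : Fin n →₀ ℕ) z := by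
        refine le_antisymm (Nat.find_min' hex (by rw [hc.1]; exact c.2.1)) (not_lt.1 fun hlt => ?_)
        refine c.2.2 _ hlt ?_
        rw [← hc.1]
        simpa using hs
      refine Subtype.ext (Subtype.ext ?_)
      simp only [h1]
      exact hc.1.symm
  · rw [← Finset.card_insert_of_notMem (a := z) (by simpa using hz)] at hk
    refine hk.trans (Finset.card_le_card (Finset.insert_subset_insert _ fun j hj => ?_))
    have hc : (c : Fin n →₀ ℕ) j ≤ N j := c.1.2 j
    simp only [Finset.mem_filter, Finset.mem_univ, true_and] at hj ⊢
    omega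

/-- The number of directions is bounded by the corners of the partitioned set. -/
lemma HasBoxPartition.le_of_corner {A : Set (Fin n →₀ ℕ)} {k : ℕ} (h : HasBoxPartition A k)
    {w : Fin n →₀ ℕ} (hw : w ∈ A) (s : Finset (Fin n))
    (hs : ∀ j ∈ s, w + Finsupp.single j 1 ∉ A) : k ≤ n - s.card := by
  obtain ⟨r, c, Z, hp, hk⟩ := h
  obtain ⟨i, hi, -⟩ := hp.existsUnique w hw
  -- A direction in s of the box through w would put a neighbour of w into A.
  have hd : Disjoint (Z i) s := Finset.disjoint_left.2 fun j hj hjs => hs j hjs <| hp.subset i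
    ⟨hi.1.trans le_self_add, fun l hl => by
      have : j ≠ l := fun e => hl (e ▸ hj)
      simp [hi.2 l hl, this]⟩
  have := (Finset.card_union_of_disjoint hd).symm.trans_le (Finset.card_le_univ _)
  have := hk i
  simp only [Fintype.card_fin] at *
  omega

end BoxPartition

/-! ### Matchings of a cycle and the interval partition -/

section IntervalPartition

/-- The sets `O` of starting points of matchings `{i, i + 1}`, `i ∈ O`, of the cycle `Fin N`. -/
def cycleMatchings (N : ℕ) [NeZero N] : Set (Finset (Fin N)) :=
  {O | ∀ i ∈ O, i + 1 ∉ O}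

lemma card_le_of_mem_cycleMatchings {q : ℕ} {O : Finset (Fin (2 * q + 1))}
    (hO : O ∈ cycleMatchings (2 * q + 1)) : O.card ≤ q := by
  have hd : Disjoint O (O.map (addRightEmbedding 1)) := by
    refine Finset.disjoint_left.2 fun j hj hj' => ?_
    obtain ⟨i, hi, rfl⟩ := Finset.mem_map.1 hj'
    exact hO i hi hj
  have := (Finset.card_union_of_disjoint hd).symm.trans_le (Finset.card_le_univ _)
  simp only [Finset.card_map, Fintype.card_fin] at this
  omega

/-- A matching of an odd cycle leaves a vertex uncovered. -/
lemma exists_notMem_of_mem_cycleMatchings {q : ℕ} {O : Finset (Fin (2 * q + 1))}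
    (hO : O ∈ cycleMatchings (2 * q + 1)) : ∃ i, i + 1 ∉ O ∧ i ∉ O := by
  by_contra! h
  have hu : (Finset.univ : Finset (Fin (2 * q + 1))) ⊆ O ∪ O.map (addRightEmbedding (-1)) := by
    intro i _
    by_cases hi : i ∈ O
    · exact Finset.mem_union_left _ hi
    · refine Finset.mem_union_right _ (Finset.mem_map.2 ⟨i + 1, ?_, by simp⟩)
      by_contra h'
      exact hi (h i h')
  have := (Finset.card_le_card hu).trans (Finset.card_union_le _ _)
  have := card_le_of_mem_cycleMatchings hO
  simp only [Finset.card_map, Finset.card_univ, Fintype.card_fin] at *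
  omega

/-- A nonempty subset of a cycle which is closed under predecessors is everything. -/
lemma Fin.forall_of_add_one {N : ℕ} [NeZero N] {p : Fin N → Prop} (x : Fin N) (hx : p x)
    (hp : ∀ i, p (i + 1) → p i) (i : Fin N) : p i := by
  have h : ∀ (m : ℕ) (i : Fin N), p (i + m • 1) → p i := by
    intro m
    induction m with
    | zero => simp
    | succ m ih =>
      intro i hi
      refine hp i (ih (i + 1) ?_)
      rwa [add_assoc, ← succ_nsmul']
  refine h ((x - i : Fin N) : ℕ) i ?_
  have : ((x - i : Fin N) : ℕ) • (1 : Fin N) = x - i := by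
    open Fin.NatCast in
    rw [nsmul_one, Fin.cast_val_eq_self]
  simpa [this] using hx

/-- Every nonempty subset `X` of a cycle lies in the interval of exactly one matching `O`: the
interval consists of the sets which contain all the uncovered vertices and avoid all the end
points `i + 1`, `i ∈ O`. -/
lemma existsUnique_cycleMatching {N : ℕ} [NeZero N] (X : Set (Fin N)) (hX : X.Nonempty) :
    ∃! O : Finset (Fin N), ∀ i, i ∈ O ↔ i + 1 ∉ X ∧ i + 1 ∉ O := by
  classical
  obtain ⟨x, hx⟩ := hX
  -- ρ i is the distance from i + 1 forward to the next vertex of X. Going backwards from X, the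
  -- condition on O alternates, so O must consist of the i with ρ i odd.
  obtain ⟨ρ, h0, h1⟩ : ∃ ρ : Fin N → ℕ, (∀ i, i + 1 ∈ X → ρ i = 0) ∧
      ∀ i, i + 1 ∉ X → ρ i = ρ (i + 1) + 1 := by
    have hex : ∀ i : Fin N, ∃ r : ℕ, i + 1 + r • 1 ∈ X := by
      refine Fin.forall_of_add_one (x - 1) ⟨0, by simpa using hx⟩ fun i ⟨r, hr⟩ => ⟨r + 1, ?_⟩
      rwa [succ_nsmul', ← add_assoc]
    refine ⟨fun i => Nat.find (hex i), fun i hi => ?_, fun i hi => ?_⟩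
    · rw [Nat.find_eq_zero]
      simpa using hi
    · have hs : ∃ r : ℕ, i + 1 + (r + 1) • 1 ∈ X := by
        simpa only [succ_nsmul', ← add_assoc] using hex (i + 1)
      refine (Nat.find_comp_succ (hex i) hs (by simpa using hi)).trans ?_
      simp only [succ_nsmul', ← add_assoc]
  refine ⟨Finset.univ.filter fun i => Odd (ρ i), fun i => ?_, fun O hO => ?_⟩
  · simp only [Finset.mem_filter, Finset.mem_univ, true_and]
    by_cases h : i + 1 ∈ X
    · simp [h0 i h, h]
    · simp [h1 i h, h, Nat.odd_add_one]
  · have hρ : ∀ i, Odd (ρ i) ↔ i + 1 ∉ X ∧ ¬ Odd (ρ (i + 1)) := fun i => by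
      by_cases h : i + 1 ∈ X
      · simp [h0 i h, h]
      · simp [h1 i h, h, Nat.odd_add_one]
    ext i
    simp only [Finset.mem_filter, Finset.mem_univ, true_and]
    refine Fin.forall_of_add_one (p := fun i => i ∈ O ↔ Odd (ρ i)) (x - 1) ?_ (fun i hi => ?_) i
    · rw [hO, hρ]; simp [hx]
    · rw [hO, hρ, hi]

end IntervalPartition

/-! ### Box partitions for (x_1, …, x_p) -/

section PrimeExponents

variable {n : ℕ}

/-- The exponents of the monomials in the ideal `(x_1, …, x_p)`. -/
def initialVarExponents (n p : ℕ) : Set (Fin n →₀ ℕ) :=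
  {d | ∃ j : Fin n, (j : ℕ) < p ∧ 0 < d j}

/-- The interval partition of Biró, Howard, Keller, Trotter and Young, as a box partition. -/
lemma hasBoxPartition_initialVarExponents {p : ℕ} (hp : p ≤ n) :
    HasBoxPartition (initialVarExponents n p) (n - p / 2) := by
  classical
  -- The cycle has odd length p or p + 1. When p is even, the extra vertex p stands for no variable
  -- and never lies in `X d`.
  set q := p / 2 with hq
  have hpN : p ≤ 2 * q + 1 := by omega
  let e : Fin n → Fin (2 * q + 1) := fun j => Fin.ofNat _ (j : ℕ)
  have he : ∀ j : Fin n, (j : ℕ) < p → (e j : ℕ) = j := fun j hj => by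
    simp only [e, Fin.ofNat]
    exact Nat.mod_eq_of_lt (by omega)
  let X : (Fin n →₀ ℕ) → Set (Fin (2 * q + 1)) := fun d =>
    {i | ∃ j : Fin n, (j : ℕ) < p ∧ e j = i ∧ 0 < d j}
  have hXe : ∀ d (j : Fin n), (j : ℕ) < p → (e j ∈ X d ↔ 0 < d j) := by
    intro d j hj
    refine ⟨fun ⟨l, hl, hlj, hd⟩ => ?_, fun h => ⟨j, hj, rfl, h⟩⟩
    have : l = j := Fin.ext (by rw [← he l hl, hlj, he j hj])
    exact this ▸ hd
  -- The last condition discards the matchings that leave the extra vertex uncovered, whose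
  -- intervals contain no `X d`.
  let ι := {O : Finset (Fin (2 * q + 1)) // O ∈ cycleMatchings (2 * q + 1) ∧
    ∀ i, i + 1 ∉ O → i ∉ O → ((i + 1 : Fin (2 * q + 1)) : ℕ) < p}
  -- The corner is the product of the uncovered variables. Only the end points of matching edges, at
  -- most q of them, fail to be directions; the value of `e` at j ≥ p plays no role.
  let c : ι → Fin n →₀ ℕ := fun O => Finsupp.equivFunOnFinite.symm fun j =>
    if (j : ℕ) < p ∧ e j ∉ O.1 ∧ e j - 1 ∉ O.1 then 1 else 0
  let Z : ι → Finset (Fin n) := fun O => Finset.univ.filter fun j =>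
    ¬ ((j : ℕ) < p ∧ e j - 1 ∈ O.1)
  have key : ∀ (O : ι) d, d ∈ exponentBox (c O) (Z O) ↔
      ∀ i, i ∈ O.1 ↔ i + 1 ∉ X d ∧ i + 1 ∉ O.1 := by
    intro O d
    constructor
    · rintro ⟨h1, h2⟩ i
      refine ⟨fun hi => ⟨?_, O.2.1 i hi⟩, fun ⟨hi, hi'⟩ => ?_⟩
      · rintro ⟨j, hj, hji, hd⟩
        have := h2 j (by simp [Z, hj, hji, hi])
        simp [c, hji, hi] at this
        omega
      · by_contra hi''
        have hlt := O.2.2 i hi' hi''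
        have hj : e ⟨_, hlt.trans_le hp⟩ = i + 1 := Fin.ext (he _ hlt)
        have := h1 ⟨_, hlt.trans_le hp⟩
        simp only [c, Finsupp.equivFunOnFinite_symm_apply_apply, hlt, hj, hi', hi'',
          add_sub_cancel_right, not_false_eq_true, and_self, if_true] at this
        exact hi (hj ▸ (hXe d _ hlt).2 this)
    · intro h
      refine ⟨fun j => ?_, fun j hj => ?_⟩
      · simp only [c, Finsupp.equivFunOnFinite_symm_apply_apply]
        split_ifs with hj
        · have := h (e j - 1)
          rw [sub_add_cancel, hXe d j hj.1] at this
          have := hj.2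
          by_contra
          grind
        · exact Nat.zero_le _
      · simp only [Z, Finset.mem_filter, Finset.mem_univ, true_and, not_not] at hj
        have := (h (e j - 1)).1 hj.2
        rw [sub_add_cancel, hXe d j hj.1] at this
        simp only [c, Finsupp.equivFunOnFinite_symm_apply_apply, hj.2]
        simp
        omega
  refine HasBoxPartition.of_finite (c := c) (Z := Z) ⟨fun O d hd => ?_, fun d hd => ?_⟩
    fun O => ?_
  · obtain ⟨i, hi, hi'⟩ := exists_notMem_of_mem_cycleMatchings O.2.1
    rw [key] at hd
    have : i + 1 ∈ X d := by
      by_contra h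
      exact hi' ((hd i).2 ⟨h, hi⟩)
    obtain ⟨j, hj, -, h⟩ := this
    exact ⟨j, hj, h⟩
  · obtain ⟨j, hj, hd⟩ := hd
    obtain ⟨O, hO, hu⟩ := existsUnique_cycleMatching (X d) ⟨e j, j, hj, rfl, hd⟩
    refine ⟨⟨O, fun i hi => ((hO i).1 hi).2, fun i hi hi' => ?_⟩, (key _ d).2 hO, fun O' hO' => ?_⟩
    · have : i + 1 ∈ X d := by
        by_contra h
        exact hi' ((hO i).2 ⟨h, hi⟩)
      obtain ⟨l, hl, hli, -⟩ := this
      rw [← hli, he l hl]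
      exact hl
    · exact Subtype.ext (hu _ ((key _ d).1 hO'))
  · have hZ : ∀ j, j ∈ (Z O)ᶜ ↔ (j : ℕ) < p ∧ e j - 1 ∈ O.1 := by simp [Z]
    have h1 : (Z O)ᶜ.card ≤ O.1.card := by
      refine Finset.card_le_card_of_injOn (fun j => e j - 1) (fun j hj => ?_) fun j hj l hl h => ?_
      · exact ((hZ j).1 hj).2
      · have : e j = e l := by simpa using h
        exact Fin.ext (by rw [← he j ((hZ j).1 hj).1, this, he l ((hZ l).1 hl).1])
    have h2 := card_le_of_mem_cycleMatchings O.2.1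
    rw [Finset.card_compl, Fintype.card_fin] at h1
    omega

/-- The box of x_j has corner x_j. If l is a direction of the box of x_j and j one of the box of
x_l, both contain x_j x_l, which is impossible for j ≠ l. Hence the boxes of x_1, …, x_p have at
most p(p - 1)/2 directions towards other variables among these, and some box has at most (p - 1)/2.
-/
lemma HasBoxPartition.le_of_initialVarExponents {p k : ℕ} (hp : p ≤ n) (hp0 : 0 < p)
    (h : HasBoxPartition (initialVarExponents n p) k) : k ≤ n - p / 2 := by
  classical
  obtain ⟨r, c, Z, hP, hk⟩ := h
  let V : Finset (Fin n) := Finset.univ.filter fun j => (j : ℕ) < p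
  have hV : V.card = p := by
    rw [Fin.card_filter_val_lt, min_eq_right hp]
  have hex : ∀ j : Fin n, ∃ i, j ∈ V → Finsupp.single j 1 ∈ exponentBox (c i) (Z i) := by
    intro j
    by_cases hj : j ∈ V
    · obtain ⟨i, hi, -⟩ := hP.existsUnique (Finsupp.single j 1) ⟨j, by simpa [V] using hj, by simp⟩
      exact ⟨i, fun _ => hi⟩
    -- For j outside V any index serves as a default; the box of x_1 shows that one exists.
    · obtain ⟨i, -⟩ := hP.existsUnique (Finsupp.single ⟨0, by omega⟩ 1)
        ⟨⟨0, by omega⟩, hp0, by simp⟩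
      exact ⟨i, fun h => absurd h hj⟩
  choose b hb using hex
  have hc : ∀ j ∈ V, c (b j) = Finsupp.single j 1 := by
    intro j hj
    refine le_antisymm (hb j hj).1 ?_
    obtain ⟨l, -, hl⟩ := hP.subset _ (corner_mem_exponentBox (c (b j)) (Z (b j)))
    have h1 := (hb j hj).1 l
    have : j = l := by
      by_contra hne
      rw [Finsupp.single_apply, if_neg hne] at h1
      omega
    subst this
    rw [Finsupp.single_le_iff]
    exact hl
  let T : Fin n → Finset (Fin n) := fun j => V.filter fun l => l ≠ j ∧ l ∈ Z (b j)
  have hT : ∀ j ∈ V, k ≤ (T j).card + (n - p) + 1 := by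
    intro j hj
    have : Z (b j) ⊆ T j ∪ Vᶜ ∪ {j} := by
      intro l hl
      simp only [T, Finset.mem_union, Finset.mem_filter, Finset.mem_compl, Finset.mem_singleton]
      tauto
    refine (hk (b j)).trans ((Finset.card_le_card this).trans ?_)
    refine (Finset.card_union_le _ _).trans ?_
    rw [Finset.card_singleton]
    gcongr
    refine (Finset.card_union_le _ _).trans ?_
    rw [Finset.card_compl, hV, Fintype.card_fin]
  have hasymm : ∀ j ∈ V, ∀ l ∈ V, l ∈ T j → j ∉ T l := by
    have hmem : ∀ j ∈ V, ∀ l, l ∈ T j →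
        Finsupp.single j 1 + Finsupp.single l 1 ∈ exponentBox (c (b j)) (Z (b j)) := by
      intro j hj l hl
      simp only [T, Finset.mem_filter] at hl
      rw [hc j hj]
      refine ⟨le_self_add, fun i hi => ?_⟩
      have : l ≠ i := fun h => hi (h ▸ hl.2.2)
      simp [this]
    intro j hj l hl hlj hjl
    have h1 := hmem j hj l hlj
    have h2 := hmem l hl j hjl
    rw [add_comm] at h2
    have h3 := hc j hj
    rw [hP.eq_of_mem h1 h2, hc l hl] at h3
    have : l = j := (Finsupp.single_left_inj one_ne_zero).1 h3
    simp [T, this] at hlj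
  -- For each ordered pair j ≠ l, at most one of l ∈ T j and j ∈ T l holds.
  have hsum : ∑ j ∈ V, (T j).card + ∑ j ∈ V, (T j).card ≤ p * (p - 1) := by
    have h1 : ∑ j ∈ V, (T j).card = ∑ j ∈ V, ∑ l ∈ V, if l ∈ T j then 1 else 0 := by
      refine Finset.sum_congr rfl fun j _ => ?_
      rw [Finset.sum_boole, Nat.cast_id]
      congr 1
      ext l
      simp only [T, Finset.mem_filter]
      tauto
    have h2 : ∑ j ∈ V, (T j).card = ∑ j ∈ V, ∑ l ∈ V, if j ∈ T l then 1 else 0 := by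
      rw [h1, Finset.sum_comm]
    nth_rewrite 1 [h1]
    rw [h2, ← Finset.sum_add_distrib]
    have h3 : p * (p - 1) = ∑ j ∈ V, (V.erase j).card := by
      rw [Finset.sum_congr rfl fun j hj => Finset.card_erase_of_mem hj]
      simp [hV]
    rw [h3]
    refine Finset.sum_le_sum fun j hj => ?_
    rw [← Finset.sum_add_distrib, Finset.card_eq_sum_ones,
      ← Finset.sum_subset (Finset.erase_subset j V)]
    · refine Finset.sum_le_sum fun l hl => ?_
      have := hasymm j hj l (Finset.mem_of_mem_erase hl)
      split_ifs <;> simp_all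
    · intro l hl hl'
      have : l = j := by by_contra h; exact hl' (Finset.mem_erase.2 ⟨h, hl⟩)
      simp [this, T]
  have hlow : p * (k - (n - p) - 1) ≤ ∑ j ∈ V, (T j).card := by
    have := Finset.card_nsmul_le_sum V (fun j => (T j).card) (k - (n - p) - 1) fun j hj => by
      have := hT j hj; omega
    simpa [hV] using this
  have h2 : p * (2 * (k - (n - p) - 1)) ≤ p * (p - 1) := by
    rw [mul_left_comm]; omega
  have := Nat.le_of_mul_le_mul_left h2 hp0
  omega

end PrimeExponents

/-! ### Stanley decompositions as box partitions -/

lemma Module.Basis.isInternal_span_image_iff {K M B : Type*} [Field K] [AddCommGroup M]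
    [Module K M] (b : Module.Basis B K M) {ι : Type*} [DecidableEq ι] (T : ι → Set B) :
    (DirectSum.IsInternal fun i => Submodule.span K (b '' T i)) ↔ ∀ d, ∃! i, d ∈ T i := by
  rw [DirectSum.isInternal_submodule_iff_iSupIndep_and_iSup_eq_top]
  have hsup : ∀ s : Set ι, (⨆ i ∈ s, Submodule.span K (b '' T i)) =
      Submodule.span K (b '' ⋃ i ∈ s, T i) := fun s => by
    simp only [Set.image_iUnion, Submodule.span_iUnion]
  have htop := hsup Set.univ
  simp only [Set.mem_univ, iSup_pos, Set.iUnion_true] at htop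
  constructor
  · rintro ⟨hind, ht⟩ d
    have hd : b d ∈ Submodule.span K (b '' ⋃ i, T i) := by rw [← htop, ht]; trivial
    rw [Module.Basis.mem_span_image, b.repr_self, Finsupp.support_single _ one_ne_zero] at hd
    obtain ⟨i, hi⟩ := Set.mem_iUnion.1 (hd (Finset.mem_coe.2 (Finset.mem_singleton_self d)))
    refine ⟨i, hi, fun j hj => ?_⟩
    by_contra hne
    refine b.ne_zero d ((Submodule.disjoint_def.1 (hind.pairwiseDisjoint hne)) _ ?_ ?_)
    · exact Submodule.subset_span ⟨d, hj, rfl⟩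
    · exact Submodule.subset_span ⟨d, hi, rfl⟩
  · intro h
    refine ⟨fun i => ?_, ?_⟩
    · have := hsup {j | j ≠ i}
      simp only [Set.mem_ofPred_eq] at this
      rw [this]
      refine b.linearIndependent.disjoint_span_image (Set.disjoint_left.2 fun d hd hd' => ?_)
      obtain ⟨j, hj, hd'⟩ := Set.mem_iUnion₂.1 hd'
      exact hj ((h d).unique hd' hd)
    · rw [htop, Set.eq_univ_of_forall fun d => Set.mem_iUnion.2 (h d).exists, Set.image_univ,
        b.span_eq]

lemma isBoxPartition_iff {n r : ℕ} {B : Set (Fin n →₀ ℕ)} {c : Fin r → Fin n →₀ ℕ}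
    {Z : Fin r → Finset (Fin n)} :
    IsBoxPartition B c Z ↔ (∀ i, exponentBox (c i) (Z i) ⊆ B) ∧
      ∀ d : B, ∃! i, d ∈ {d : B | (d : Fin n →₀ ℕ) ∈ exponentBox (c i) (Z i)} :=
  ⟨fun h => ⟨h.1, fun d => h.2 d d.2⟩, fun h => ⟨h.1, fun d hd => h.2 ⟨d, hd⟩⟩⟩

section MonomialBasis

variable {K : Type*} [Field K] {n : ℕ} {M : Type*} [AddCommGroup M] [Module K M]
  [Module (MvPolynomial (Fin n) K) M] [IsScalarTower K (MvPolynomial (Fin n) K) M]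

lemma toSubmodule_supported_eq_span (Z : Finset (Fin n)) :
    Subalgebra.toSubmodule (supported K (Z : Set (Fin n))) =
      Submodule.span K ((fun e => monomial e (1 : K)) '' {e | e.support ⊆ Z}) := by
  refine le_antisymm (fun p hp => ?_) (Submodule.span_le.2 ?_)
  · rw [Subalgebra.mem_toSubmodule, mem_supported] at hp
    rw [p.as_sum]
    refine Submodule.sum_mem _ fun e he => ?_
    rw [show monomial e (coeff e p) = coeff e p • monomial e (1 : K) by
      rw [smul_monomial, smul_eq_mul, mul_one]]
    refine Submodule.smul_mem _ _ (Submodule.subset_span ⟨e, fun j hj => ?_, rfl⟩)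
    exact_mod_cast hp ((mem_vars_iff_mem_support _).2 ⟨e, he, hj⟩)
  · rintro _ ⟨e, he, rfl⟩
    simp only [SetLike.mem_coe, Subalgebra.mem_toSubmodule, mem_supported]
    rw [vars_monomial one_ne_zero]
    exact_mod_cast he

/-- A `K`-basis of a graded `S`-module consisting of one element `b d` of degree `d` for each
exponent `d ∈ B`, on which monomials act by adding exponents. -/
structure IsMonomialBasis (ℳ : (Fin n → ℤ) → Submodule K M) {B : Set (Fin n →₀ ℕ)}
    (b : Module.Basis B K M) : Prop where
  monomial_smul : ∀ (d : B) e (h : (d : Fin n →₀ ℕ) + e ∈ B),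
    monomial e (1 : K) • b d = b ⟨d + e, h⟩
  monomial_smul_eq_zero : ∀ (d : B) e, (d : Fin n →₀ ℕ) + e ∉ B → monomial e (1 : K) • b d = 0
  part_eq : ∀ a, ℳ a = Submodule.span K (b '' {d | ∀ j, ((d : Fin n →₀ ℕ) j : ℤ) = a j})

lemma exists_add_of_mem_exponentBox {c d : Fin n →₀ ℕ} {Z : Finset (Fin n)}
    (h : d ∈ exponentBox c Z) : ∃ e : Fin n →₀ ℕ, e.support ⊆ Z ∧ d = c + e := by
  refine ⟨d - c, fun j hj => ?_, (add_tsub_cancel_of_le h.1).symm⟩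
  by_contra hj'
  simp [h.2 j hj'] at hj

lemma add_mem_exponentBox {c e : Fin n →₀ ℕ} {Z : Finset (Fin n)} (he : e.support ⊆ Z) :
    c + e ∈ exponentBox c Z :=
  ⟨le_self_add, fun j hj => by simpa using fun h => hj (he (Finsupp.mem_support_iff.2 h))⟩

namespace IsMonomialBasis

variable {ℳ : (Fin n → ℤ) → Submodule K M} {B : Set (Fin n →₀ ℕ)} {b : Module.Basis B K M}
  (hb : IsMonomialBasis ℳ b)
include hb

lemma stanleySpace_eq {c : B} {l : K} (hl : l ≠ 0) {Z : Finset (Fin n)}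
    (hZ : exponentBox (c : Fin n →₀ ℕ) Z ⊆ B) :
    stanleySpace (l • b c) Z = Submodule.span K (b '' {d | (d : Fin n →₀ ℕ) ∈ exponentBox c Z}) := by
  have hsmul : ∀ e (he : e.support ⊆ Z), monomial e (1 : K) • l • b c =
      l • b ⟨(c : Fin n →₀ ℕ) + e, hZ (add_mem_exponentBox he)⟩ := fun e he => by
    rw [smul_comm, hb.monomial_smul]
  rw [stanleySpace, toSubmodule_supported_eq_span, Submodule.map_span]
  refine le_antisymm (Submodule.span_le.2 ?_) (Submodule.span_le.2 ?_)
  · rintro _ ⟨_, ⟨e, he, rfl⟩, rfl⟩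
    simp only [LinearMap.coe_restrictScalars, LinearMap.toSpanSingleton_apply, SetLike.mem_coe]
    rw [hsmul e he]
    exact Submodule.smul_mem _ _ (Submodule.subset_span ⟨_, add_mem_exponentBox he, rfl⟩)
  · rintro _ ⟨d, hd, rfl⟩
    obtain ⟨e, he, hde⟩ := exists_add_of_mem_exponentBox hd
    have : b d = l⁻¹ • (monomial e (1 : K) • l • b c) := by
      rw [hsmul e he, inv_smul_smul₀ hl]
      congr 1
      exact Subtype.ext hde
    rw [this]
    exact Submodule.smul_mem _ _ (Submodule.subset_span ⟨_, ⟨e, he, rfl⟩, rfl⟩)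

lemma repr_smul {c : B} {Z : Finset (Fin n)} (hZ : exponentBox (c : Fin n →₀ ℕ) Z ⊆ B)
    {p : MvPolynomial (Fin n) K} (hp : p ∈ supported K (Z : Set (Fin n))) (e : Fin n →₀ ℕ)
    (he : e.support ⊆ Z) :
    b.repr (p • b c) ⟨c + e, hZ (add_mem_exponentBox he)⟩ = coeff e p := by
  classical
  rw [← Subalgebra.mem_toSubmodule, toSubmodule_supported_eq_span] at hp
  induction hp using Submodule.span_induction with
  | mem p hp =>
    obtain ⟨e', he', rfl⟩ := hp
    simp only
    rw [hb.monomial_smul c e' (hZ (add_mem_exponentBox he')), Module.Basis.repr_self,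
      Finsupp.single_apply, coeff_monomial]
    simp
  | zero => simp
  | add p q _ _ hp hq => rw [add_smul, map_add, Finsupp.add_apply, hp, hq, coeff_add]
  | smul a p _ hp => rw [smul_assoc, map_smul, Finsupp.smul_apply, hp, coeff_smul]

/-- If the box leaves B at c + e, then the nonzero monomial x^e kills the generator. If it stays in
B, the coefficients of p can be read off from the coordinates of p • b c. -/
lemma free_iff {c : B} {l : K} (hl : l ≠ 0) {Z : Finset (Fin n)} :
    (Function.Injective fun p : supported K (Z : Set (Fin n)) =>
      (p : MvPolynomial (Fin n) K) • l • b c) ↔ exponentBox (c : Fin n →₀ ℕ) Z ⊆ B := by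
  refine ⟨fun h d hd => ?_, fun hZ p q hpq => ?_⟩
  · obtain ⟨e, he, rfl⟩ := exists_add_of_mem_exponentBox hd
    by_contra hB
    have hmem : monomial e (1 : K) ∈ supported K (Z : Set (Fin n)) := by
      rw [mem_supported, vars_monomial one_ne_zero]
      exact_mod_cast he
    have : (⟨_, hmem⟩ : supported K (Z : Set (Fin n))) = 0 := h (by
      simp only [ZeroMemClass.coe_zero, zero_smul]
      rw [smul_comm, hb.monomial_smul_eq_zero c e hB, smul_zero])
    have : monomial e (1 : K) = 0 := congrArg Subtype.val this
    simp at this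
  · simp only [smul_comm _ l] at hpq
    replace hpq := smul_right_injective M hl hpq
    refine Subtype.ext (MvPolynomial.ext _ _ fun e => ?_)
    by_cases he : e.support ⊆ Z
    · rw [← hb.repr_smul hZ p.2 e he, ← hb.repr_smul hZ q.2 e he, hpq]
    · have hz : ∀ p ∈ supported K (Z : Set (Fin n)), coeff e p = 0 := fun p hp => by
        by_contra hne
        rw [mem_supported] at hp
        exact he fun j hj => by
          exact_mod_cast hp ((mem_vars_iff_mem_support _).2 ⟨e, mem_support_iff.2 hne, hj⟩)
      rw [hz _ p.2, hz _ q.2]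

omit [IsScalarTower K (MvPolynomial (Fin n) K) M] in
-- Each graded component is spanned by at most one basis vector, so homogeneous generators are
-- monomials up to a scalar.
lemma exists_eq_smul {a : Fin n → ℤ} {u : M} (hu : u ∈ ℳ a) (h0 : u ≠ 0) :
    ∃ (c : B) (l : K), l ≠ 0 ∧ u = l • b c := by
  rw [hb.part_eq] at hu
  have hsub : ({d : B | ∀ j, ((d : Fin n →₀ ℕ) j : ℤ) = a j}).Subsingleton := fun d hd e he =>
    Subtype.ext (Finsupp.ext fun j => by exact_mod_cast (hd j).trans (he j).symm)
  rcases hsub.eq_empty_or_singleton with h | ⟨c, h⟩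
  · rw [h, Set.image_empty, Submodule.span_empty, Submodule.mem_bot] at hu
    exact absurd hu h0
  · rw [h, Set.image_singleton, Submodule.mem_span_singleton] at hu
    obtain ⟨l, rfl⟩ := hu
    exact ⟨c, l, fun hl => h0 (by rw [hl, zero_smul]), rfl⟩

lemma hasBoxPartition_of_stanleyDecomposition (D : StanleyDecomposition ℳ) {k : ℕ}
    (hk : (k : ℕ∞) ≤ D.sdepth) : HasBoxPartition B k := by
  have hne : ∀ i, D.u i ≠ 0 := fun i h0 => by
    have := @D.free i 1 0 (by simp [h0])
    exact one_ne_zero this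
  choose a ha using D.homogeneous
  choose c l hl hu using fun i => hb.exists_eq_smul (ha i) (hne i)
  have hZ : ∀ i, exponentBox (c i : Fin n →₀ ℕ) (D.Z i) ⊆ B := fun i =>
    (hb.free_iff (hl i)).1 (hu i ▸ D.free i)
  have hint := D.internal
  have heq : (fun i => (stanleySpace (D.u i) (D.Z i) : Submodule K M)) = fun i =>
      Submodule.span K (b '' {d | (d : Fin n →₀ ℕ) ∈ exponentBox (c i) (D.Z i)}) := by
    funext i
    rw [hu i, hb.stanleySpace_eq (hl i) (hZ i)]
  rw [heq, b.isInternal_span_image_iff] at hint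
  refine ⟨D.r, fun i => c i, D.Z, isBoxPartition_iff.2 ⟨hZ, hint⟩, fun i => ?_⟩
  exact_mod_cast hk.trans (iInf_le _ i)

lemma exists_stanleyDecomposition {k : ℕ} (h : HasBoxPartition B k) :
    ∃ D : StanleyDecomposition ℳ, (k : ℕ∞) ≤ D.sdepth := by
  obtain ⟨r, c, Z, hp, hk⟩ := h
  have hc : ∀ i, c i ∈ B := fun i => hp.subset i (corner_mem_exponentBox _ _)
  obtain ⟨hZ, hint⟩ := isBoxPartition_iff.1 hp
  refine ⟨⟨r, fun i => (1 : K) • b ⟨c i, hc i⟩, Z, fun i => ⟨fun j => c i j, ?_⟩,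
    fun i => (hb.free_iff one_ne_zero).2 (hZ i), ?_⟩, le_iInf fun i => ?_⟩
  · rw [one_smul, hb.part_eq]
    exact Submodule.subset_span ⟨_, fun _ => rfl, rfl⟩
  · have heq : (fun i => (stanleySpace ((1 : K) • b ⟨c i, hc i⟩) (Z i) : Submodule K M)) = fun i =>
        Submodule.span K (b '' {d | (d : Fin n →₀ ℕ) ∈ exponentBox (c i) (Z i)}) := by
      funext i
      rw [hb.stanleySpace_eq one_ne_zero (hZ i)]
    rw [heq, b.isInternal_span_image_iff]
    exact hint
  · exact_mod_cast hk i

/-- The Stanley depth is computed by box partitions of the set of exponents. -/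
lemma le_sdepth_iff {k : ℕ} : (k : ℕ∞) ≤ sdepth ℳ ↔ k = 0 ∨ HasBoxPartition B k := by
  rcases k with _ | k
  · simp
  · simp only [Nat.add_one_ne_zero, false_or]
    refine ⟨fun h => ?_, fun h => ?_⟩
    -- A strict inequality below the supremum produces an actual decomposition, and integrality
    -- recovers the bound k + 1.
    · have : (k : ℕ∞) < sdepth ℳ := lt_of_lt_of_le (by exact_mod_cast k.lt_succ_self) h
      obtain ⟨D, hD⟩ := lt_iSup_iff.1 this
      exact hb.hasBoxPartition_of_stanleyDecomposition D
        (by simpa using Order.add_one_le_of_lt hD)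
    · obtain ⟨D, hD⟩ := hb.exists_stanleyDecomposition h
      exact hD.trans (le_iSup (fun D : StanleyDecomposition ℳ => D.sdepth) D)

lemma le_sdepth {k : ℕ} (h : HasBoxPartition B k) : (k : ℕ∞) ≤ sdepth ℳ :=
  hb.le_sdepth_iff.2 (Or.inr h)

lemma sdepth_le {k : ℕ} (h : ∀ l, HasBoxPartition B l → l ≤ k) : sdepth ℳ ≤ k := by
  refine ENat.forall_natCast_le_iff_le.1 fun l hl => ?_
  rcases hb.le_sdepth_iff.1 hl with rfl | hl
  · simp
  · exact_mod_cast h l hl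

lemma sdepth_le_sdepth {M' : Type*} [AddCommGroup M'] [Module K M']
    [Module (MvPolynomial (Fin n) K) M'] [IsScalarTower K (MvPolynomial (Fin n) K) M']
    {ℳ' : (Fin n → ℤ) → Submodule K M'} {B' : Set (Fin n →₀ ℕ)} {b' : Module.Basis B' K M'}
    (hb' : IsMonomialBasis ℳ' b') (h : ∀ k, HasBoxPartition B k → HasBoxPartition B' k) :
    sdepth ℳ ≤ sdepth ℳ' := by
  refine ENat.forall_natCast_le_iff_le.1 fun l hl => ?_
  exact hb'.le_sdepth_iff.2 ((hb.le_sdepth_iff.1 hl).imp_right (h l))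

end IsMonomialBasis

end MonomialBasis

/-! ### Monomial ideals and their monomial bases -/

section MonomialIdeal

variable {K : Type*} [Field K] {n : ℕ} {I J : Ideal (MvPolynomial (Fin n) K)}

/-- The exponents of the monomials in an ideal. -/
def idealExponents (I : Ideal (MvPolynomial (Fin n) K)) : Set (Fin n →₀ ℕ) :=
  {d | monomial d (1 : K) ∈ I}

lemma mem_idealExponents {d : Fin n →₀ ℕ} : d ∈ idealExponents I ↔ monomial d (1 : K) ∈ I :=
  Iff.rfl

lemma add_mem_idealExponents {d : Fin n →₀ ℕ} (hd : d ∈ idealExponents I) (e : Fin n →₀ ℕ) :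
    d + e ∈ idealExponents I := by
  rw [mem_idealExponents, ← one_mul (1 : K), ← monomial_mul]
  exact I.mul_mem_right _ hd

lemma isUpperSet_idealExponents : IsUpperSet (idealExponents I) := fun d e hde hd => by
  rw [← add_tsub_cancel_of_le hde]
  exact add_mem_idealExponents hd _

lemma mem_idealExponents_span_iff {A : Set (Fin n →₀ ℕ)} {d : Fin n →₀ ℕ} :
    d ∈ idealExponents (Ideal.span ((fun d => monomial d (1 : K)) '' A)) ↔ ∃ a ∈ A, a ≤ d := by
  classical
  rw [mem_idealExponents, mem_ideal_span_monomial_image, support_monomial, if_neg one_ne_zero]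
  simp

lemma IsMonomialIdeal.mem_iff (hI : IsMonomialIdeal I) {f : MvPolynomial (Fin n) K} :
    f ∈ I ↔ ∀ d ∈ f.support, d ∈ idealExponents I := by
  obtain ⟨A, rfl⟩ := hI
  simp only [mem_idealExponents_span_iff]
  exact mem_ideal_span_monomial_image

lemma isMonomialIdeal_of_mem (h : ∀ f ∈ I, ∀ d ∈ f.support, d ∈ idealExponents I) :
    IsMonomialIdeal I := by
  refine ⟨idealExponents I, le_antisymm (fun f hf => ?_) (Ideal.span_le.2 ?_)⟩
  · exact mem_ideal_span_monomial_image.2 fun d hd => ⟨d, h f hf d hd, le_rfl⟩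
  · rintro _ ⟨d, hd, rfl⟩
    exact hd

lemma IsMonomialIdeal.sup (hI : IsMonomialIdeal I) (hJ : IsMonomialIdeal J) :
    IsMonomialIdeal (I ⊔ J) := by
  obtain ⟨A, rfl⟩ := hI
  obtain ⟨B, rfl⟩ := hJ
  exact ⟨A ∪ B, by rw [Set.image_union, Ideal.span_union]⟩

lemma IsMonomialIdeal.mem_idealExponents_sup (hI : IsMonomialIdeal I) (hJ : IsMonomialIdeal J)
    {d : Fin n →₀ ℕ} :
    d ∈ idealExponents (I ⊔ J) ↔ d ∈ idealExponents I ∨ d ∈ idealExponents J := by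
  obtain ⟨A, rfl⟩ := hI
  obtain ⟨B, rfl⟩ := hJ
  rw [← Ideal.span_union, ← Set.image_union]
  simp only [mem_idealExponents_span_iff, Set.mem_union, or_and_right, exists_or]

lemma span_monomial_mul_span_monomial (A B : Set (Fin n →₀ ℕ)) :
    Ideal.span ((fun d => monomial d (1 : K)) '' A) *
      Ideal.span ((fun d => monomial d (1 : K)) '' B) =
      Ideal.span ((fun d => monomial d (1 : K)) '' {d | ∃ a ∈ A, ∃ b ∈ B, a + b = d}) := by
  rw [Ideal.span_mul_span']
  congr 1
  ext f
  simp only [Set.mem_mul, Set.mem_image, exists_exists_and_eq_and, monomial_mul, mul_one,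
    Set.mem_ofPred_eq]
  constructor
  · rintro ⟨a, ha, b, hb, rfl⟩
    exact ⟨a + b, ⟨a, ha, b, hb, rfl⟩, rfl⟩
  · rintro ⟨_, ⟨a, ha, b, hb, rfl⟩, rfl⟩
    exact ⟨a, ha, b, hb, rfl⟩

lemma IsMonomialIdeal.mul (hI : IsMonomialIdeal I) (hJ : IsMonomialIdeal J) :
    IsMonomialIdeal (I * J) := by
  obtain ⟨A, rfl⟩ := hI
  obtain ⟨B, rfl⟩ := hJ
  exact ⟨_, span_monomial_mul_span_monomial A B⟩

lemma span_X_image_eq (s : Set (Fin n)) :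
    (Ideal.span (X '' s) : Ideal (MvPolynomial (Fin n) K)) =
      Ideal.span ((fun d => monomial d (1 : K)) '' ((fun j => Finsupp.single j 1) '' s)) := by
  rw [Set.image_image]
  rfl

lemma isMonomialIdeal_span_X_image (s : Set (Fin n)) :
    IsMonomialIdeal (Ideal.span (X '' s) : Ideal (MvPolynomial (Fin n) K)) :=
  ⟨_, span_X_image_eq s⟩

lemma mem_idealExponents_span_X_image {s : Set (Fin n)} {d : Fin n →₀ ℕ} :
    d ∈ idealExponents (Ideal.span (X '' s) : Ideal (MvPolynomial (Fin n) K)) ↔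
      ∃ j ∈ s, 0 < d j := by
  rw [span_X_image_eq, mem_idealExponents_span_iff]
  simp [Nat.one_le_iff_ne_zero, Nat.pos_iff_ne_zero]

lemma mem_idealExponents_span_X_image_mul (hI : IsMonomialIdeal I) {s : Set (Fin n)}
    {d : Fin n →₀ ℕ} : d ∈ idealExponents (Ideal.span (X '' s) * I) ↔
      ∃ j ∈ s, ∃ a ∈ idealExponents I, Finsupp.single j 1 + a = d := by
  obtain ⟨A, rfl⟩ := hI
  rw [span_X_image_eq, span_monomial_mul_span_monomial, mem_idealExponents_span_iff]
  simp only [mem_idealExponents_span_iff, Set.mem_ofPred_eq]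
  constructor
  · rintro ⟨_, ⟨_, ⟨j, hj, rfl⟩, a, ha, rfl⟩, h⟩
    refine ⟨j, hj, d - Finsupp.single j 1, ⟨a, ha, ?_⟩, ?_⟩
    · exact le_tsub_of_add_le_left h
    · exact add_tsub_cancel_of_le (le_self_add.trans h)
  · rintro ⟨j, hj, a, ⟨b, hb, hba⟩, rfl⟩
    exact ⟨_, ⟨_, ⟨j, hj, rfl⟩, b, hb, rfl⟩, by gcongr⟩

lemma initialVarIdeal_exponents (p : ℕ) :
    idealExponents (initialVarIdeal K n p) = initialVarExponents n p := by
  ext d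
  exact mem_idealExponents_span_X_image

lemma linearIndependent_monomials (A : Set (Fin n →₀ ℕ)) :
    LinearIndependent K fun d : A => (monomial (d : Fin n →₀ ℕ) (1 : K)) := by
  have := (basisMonomials (Fin n) K).linearIndependent.comp ((↑) : A → Fin n →₀ ℕ)
    Subtype.val_injective
  simpa [Function.comp_def] using this

lemma span_range_monomials (A : Set (Fin n →₀ ℕ)) :
    Submodule.span K (Set.range fun d : A => (monomial (d : Fin n →₀ ℕ) (1 : K))) =
      restrictSupport K A := by
  rw [restrictSupport_eq_span, Set.image_eq_range]

/-- The monomials in an ideal, as elements of the ideal. -/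
def idealMonomial (I : Ideal (MvPolynomial (Fin n) K)) (d : idealExponents I) : I :=
  ⟨monomial (d : Fin n →₀ ℕ) 1, d.2⟩

lemma mem_span_idealMonomial_iff {T : Set (idealExponents I)} {f : I} :
    f ∈ Submodule.span K (idealMonomial I '' T) ↔
      ∀ d ∈ (f : MvPolynomial (Fin n) K).support, ∃ h : d ∈ idealExponents I, ⟨d, h⟩ ∈ T := by
  have hinj : Function.Injective ((Submodule.subtype I).restrictScalars K) :=
    Subtype.val_injective
  have h1 : f ∈ Submodule.span K (idealMonomial I '' T) ↔
      (f : MvPolynomial (Fin n) K) ∈ restrictSupport K ((↑) '' T : Set (Fin n →₀ ℕ)) := by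
    rw [← Submodule.comap_map_eq_of_injective hinj (Submodule.span K _), Submodule.map_span,
      restrictSupport_eq_span, Set.image_image, Set.image_image]
    rfl
  rw [h1, mem_restrictSupport_iff]
  refine forall₂_congr fun d _ => ?_
  simp

/-- The basis of a monomial ideal consisting of its monomials. -/
def IsMonomialIdeal.basis (hI : IsMonomialIdeal I) :
    Module.Basis (idealExponents I) K I :=
  Module.Basis.mk (v := idealMonomial I)
    (LinearIndependent.of_comp ((Submodule.subtype I).restrictScalars K)
      (linearIndependent_monomials (idealExponents I)))
    (fun f _ => by
      rw [← Set.image_univ, mem_span_idealMonomial_iff]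
      exact fun d hd => ⟨hI.mem_iff.1 f.2 d hd, trivial⟩)

lemma IsMonomialIdeal.coe_basis (hI : IsMonomialIdeal I) : ⇑hI.basis = idealMonomial I :=
  Module.Basis.coe_mk _ _

lemma IsMonomialIdeal.isMonomialBasis_basis (hI : IsMonomialIdeal I) :
    IsMonomialBasis (idealPart I) hI.basis where
  monomial_smul d e h := by
    rw [hI.coe_basis]
    refine Subtype.ext ?_
    simp [idealMonomial, monomial_mul, add_comm]
  monomial_smul_eq_zero d e h := absurd (add_mem_idealExponents d.2 e) h
  part_eq a := by
    ext f
    rw [hI.coe_basis, mem_span_idealMonomial_iff]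
    simp only [idealPart, polyPart, Submodule.mem_comap, mem_restrictSupport_iff]
    exact ⟨fun h d hd => ⟨hI.mem_iff.1 f.2 d hd, h hd⟩, fun h d hd => (h d hd).2⟩

/-- The residue classes of the monomials outside an ideal. -/
def quotMonomial (I : Ideal (MvPolynomial (Fin n) K)) (d : ((idealExponents I)ᶜ : Set _)) :
    MvPolynomial (Fin n) K ⧸ I :=
  (Submodule.mkQ I).restrictScalars K (monomial (d : Fin n →₀ ℕ) 1)

lemma mkQ_monomial_mem_span_quotMonomial {T : Set ((idealExponents I)ᶜ : Set (Fin n →₀ ℕ))}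
    {A : Set (Fin n →₀ ℕ)} (hT : ∀ d ∈ A, ∀ h : d ∉ idealExponents I, ⟨d, h⟩ ∈ T) :
    (restrictSupport K A).map ((Submodule.mkQ I).restrictScalars K) ≤
      Submodule.span K (quotMonomial I '' T) := by
  rw [restrictSupport_eq_span, Submodule.map_span, Submodule.span_le]
  rintro _ ⟨_, ⟨d, hd, rfl⟩, rfl⟩
  by_cases h : d ∈ idealExponents I
  · have : (Submodule.mkQ I).restrictScalars K (monomial d (1 : K)) = 0 :=
      (Submodule.Quotient.mk_eq_zero I).2 h
    simp only [this, SetLike.mem_coe, Submodule.zero_mem]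
  · exact Submodule.subset_span ⟨⟨d, h⟩, hT d hd h, rfl⟩

/-- The basis of the quotient by a monomial ideal consisting of the remaining monomials. -/
def IsMonomialIdeal.quotBasis (hI : IsMonomialIdeal I) :
    Module.Basis ((idealExponents I)ᶜ : Set (Fin n →₀ ℕ)) K (MvPolynomial (Fin n) K ⧸ I) :=
  Module.Basis.mk (v := quotMonomial I)
    ((linearIndependent_monomials _).map (f := (Submodule.mkQ I).restrictScalars K) (by
      rw [span_range_monomials, Submodule.disjoint_def]
      intro f hf hf'
      have hf' : f ∈ I := (Submodule.Quotient.mk_eq_zero I).1 hf'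
      rw [← support_eq_empty, Finset.eq_empty_iff_forall_notMem]
      exact fun d hd => hf hd (hI.mem_iff.1 hf' d hd)))
    (by
      rw [← Set.image_univ]
      refine le_trans ?_ (mkQ_monomial_mem_span_quotMonomial (A := Set.univ) (by simp))
      rw [restrictSupport_univ, Submodule.map_top]
      exact fun f _ => Submodule.mkQ_surjective I f)

lemma IsMonomialIdeal.coe_quotBasis (hI : IsMonomialIdeal I) : ⇑hI.quotBasis = quotMonomial I :=
  Module.Basis.coe_mk _ _

lemma IsMonomialIdeal.isMonomialBasis_quotBasis (hI : IsMonomialIdeal I) :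
    IsMonomialBasis (quotPart I) hI.quotBasis where
  monomial_smul d e h := by
    rw [hI.coe_quotBasis]
    change Submodule.Quotient.mk (monomial e (1 : K) * monomial (d : Fin n →₀ ℕ) 1) = _
    rw [monomial_mul, mul_one, add_comm]
    rfl
  monomial_smul_eq_zero d e h := by
    rw [hI.coe_quotBasis]
    change Submodule.Quotient.mk (monomial e (1 : K) * monomial (d : Fin n →₀ ℕ) 1) = _
    rw [monomial_mul, mul_one, add_comm]
    exact (Submodule.Quotient.mk_eq_zero I).2 (not_not.1 h)
  part_eq a := by
    rw [hI.coe_quotBasis]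
    refine le_antisymm (mkQ_monomial_mem_span_quotMonomial fun d hd h => hd)
      (Submodule.span_le.2 ?_)
    rintro _ ⟨d, hd, rfl⟩
    exact Submodule.mem_map_of_mem ((monomial_mem_restrictSupport K).2 (Or.inl hd))

end MonomialIdeal

/-! ### Depth from a socle element -/

section Depth

open RingTheory.Sequence CategoryTheory Abelian Limits Pointwise

universe u

variable {R : Type u} [CommRing R] [IsNoetherianRing R]

/-- If `M` has a regular sequence of length `t + 1` in `I`, then its quotient by a regular element
of `I` has one of length `t`. -/
lemma exists_isRegular_quotSMulTop {M : Type u} [AddCommGroup M] [Module R M] [Module.Finite R M]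
    {I : Ideal R} (hI : I • (⊤ : Submodule R M) ≠ ⊤) {x : R} (hx : x ∈ I)
    (hreg : IsSMulRegular M x) {rs : List R} (hrs : ∀ r ∈ rs, r ∈ I) (h : IsRegular M rs) {t : ℕ}
    (ht : rs.length = t + 1) :
    ∃ rs' : List R, rs'.length = t ∧ (∀ r ∈ rs', r ∈ I) ∧ IsRegular (QuotSMulTop x M) rs' := by
  have hI' : I • (⊤ : Submodule R (QuotSMulTop x M)) ≠ ⊤ := by
    intro eq
    have h1 := congrArg (Submodule.comap (Submodule.mkQ (x • (⊤ : Submodule R M)))) eq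
    rw [Submodule.comap_smul_top_of_surjective I _ (Submodule.mkQ_surjective _),
      Submodule.ker_mkQ, Submodule.comap_top, sup_eq_left.2] at h1
    · exact hI h1
    · rw [← Submodule.ideal_span_singleton_smul]
      exact Submodule.smul_mono_left ((Ideal.span_singleton_le_iff_mem I).2 hx)
  -- Regular sequences of given length in I are detected by the vanishing of Ext(R/I, -) in low
  -- degrees; the long exact sequence of multiplication by x on M costs one degree.
  have h1 : ∀ i < t + 1, Subsingleton
      (Ext (ModuleCat.of R (Shrink.{u} (R ⧸ I))) (ModuleCat.of R M) i) :=
    ((ModuleCat.exists_isRegular_tfae I (t + 1) (ModuleCat.of R M) hI.lt_top).out 1 3 rfl rfl).2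
      ⟨rs, ht, hrs, h⟩
  refine ((ModuleCat.exists_isRegular_tfae I t (ModuleCat.of R (QuotSMulTop x M))
    hI'.lt_top).out 1 3 rfl rfl).1 fun i hi => ?_
  have zero1 := AddCommGrpCat.isZero_of_iff_subsingleton.mpr (h1 i (by omega))
  have zero2 := AddCommGrpCat.isZero_of_iff_subsingleton.mpr (h1 (i + 1) (by omega))
  exact AddCommGrpCat.subsingleton_of_isZero <| ShortComplex.Exact.isZero_of_both_zeros
    ((Ext.covariant_sequence_exact₃' _
      (IsSMulRegular.smulShortComplex_shortExact (M := ModuleCat.of R M) hreg)) i (i + 1) rfl)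
    (zero1.eq_zero_of_src _) (zero2.eq_zero_of_tgt _)

/-- A weakly regular sequence in `I` whose quotient contains a nonzero element annihilated by `I`
is a longest regular sequence in `I`. -/
lemma length_le_of_socle {I : Ideal R} {M : Type u} [AddCommGroup M] [Module R M]
    [Module.Finite R M] (rs : List R) (hrs : ∀ r ∈ rs, r ∈ I) (hreg : IsWeaklyRegular M rs) (v : M)
    (hv : v ∉ Ideal.ofList rs • (⊤ : Submodule R M))
    (hIv : ∀ f ∈ I, f • v ∈ Ideal.ofList rs • (⊤ : Submodule R M)) (rs' : List R)
    (hrs' : ∀ r ∈ rs', r ∈ I) (hreg' : IsRegular M rs') : rs'.length ≤ rs.length := by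
  induction rs generalizing M rs' with
  | nil =>
    rcases rs' with _ | ⟨y, rs'⟩
    · simp
    · simp only [Ideal.ofList_nil, Submodule.bot_smul, Submodule.mem_bot] at hv hIv
      rw [isRegular_cons_iff] at hreg'
      exact absurd (hreg'.1.right_eq_zero_of_smul (hIv y (hrs' y (by simp)))) hv
  | cons x rs ih =>
    have hI : I • (⊤ : Submodule R M) ≠ ⊤ := by
      intro h
      -- If IM = M, some r with r - 1 ∈ I annihilates M; then (r - 1)v = -v would lie in the
      -- submodule excluded by `hv`.
      obtain ⟨r, hr, hr0⟩ := Submodule.exists_sub_one_mem_and_smul_eq_zero_of_fg_of_le_smul I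
        (⊤ : Submodule R M) Module.Finite.fg_top h.ge
      refine hv ?_
      have := hIv _ hr
      rwa [sub_smul, hr0 v trivial, zero_sub, one_smul, neg_mem_iff] at this
    rw [isWeaklyRegular_cons_iff] at hreg
    rcases hlen : rs'.length with _ | t
    · simp
    · obtain ⟨rs₂, h1, h2, h3⟩ := exists_isRegular_quotSMulTop hI (hrs x (by simp)) hreg.1 hrs'
        hreg' hlen
      -- The quotient of M/xM by `rs` is the quotient of M by x :: rs, so the class of v serves for
      -- the induction.
      have key : ∀ w : M, (Submodule.Quotient.mk w : QuotSMulTop x M) ∈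
          Ideal.ofList rs • (⊤ : Submodule R (QuotSMulTop x M)) ↔
          w ∈ Ideal.ofList (x :: rs) • (⊤ : Submodule R M) := by
        intro w
        have := Submodule.comap_smul_top_of_surjective (Ideal.ofList rs)
          (x • (⊤ : Submodule R M)).mkQ (Submodule.mkQ_surjective _)
        rw [Submodule.ker_mkQ] at this
        rw [Ideal.ofList_cons_smul, sup_comm, ← this]
        rfl
      have := ih (fun r hr => hrs r (List.mem_cons_of_mem _ hr)) hreg.2 (Submodule.Quotient.mk v)
        (mt (key v).1 hv) (fun f hf => (key (f • v)).2 (hIv f hf)) rs₂ h2 h3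
      simp only [List.length_cons]
      omega

lemma polyDepth_eq_length {K : Type u} [Field K] {n : ℕ} {M : Type u} [AddCommGroup M]
    [Module (MvPolynomial (Fin n) K) M] [Module.Finite (MvPolynomial (Fin n) K) M]
    (rs : List (MvPolynomial (Fin n) K)) (hrs : ∀ r ∈ rs, r ∈ idealOfVars (Fin n) K)
    (hreg : IsWeaklyRegular M rs) (v : M)
    (hv : v ∉ Ideal.ofList rs • (⊤ : Submodule (MvPolynomial (Fin n) K) M))
    (hIv : ∀ j, (X j : MvPolynomial (Fin n) K) • v ∈
      Ideal.ofList rs • (⊤ : Submodule (MvPolynomial (Fin n) K) M)) :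
    polyDepth K n M = rs.length := by
  have hIv' : ∀ f ∈ idealOfVars (Fin n) K, f • v ∈
      Ideal.ofList rs • (⊤ : Submodule (MvPolynomial (Fin n) K) M) := by
    intro f hf
    induction hf using Submodule.span_induction with
    | mem f hf =>
      obtain ⟨j, rfl⟩ := hf
      exact hIv j
    | zero => simp
    | add f g _ _ hf hg => rw [add_smul]; exact add_mem hf hg
    | smul a f _ hf => rw [smul_assoc]; exact Submodule.smul_mem _ _ hf
  refine le_antisymm (iSup_le fun rs' => ?_) ?_
  · exact_mod_cast length_le_of_socle rs hrs hreg v hv hIv' rs'.1 rs'.2.1 rs'.2.2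
  · refine le_iSup_of_le ⟨rs, hrs, hreg, fun h => hv ?_⟩ le_rfl
    rw [← h]
    trivial

end Depth

/-! ### Regular sequences of variables -/

section VariableSequences

open RingTheory.Sequence

variable {K : Type*} [Field K] {n : ℕ} {I : Ideal (MvPolynomial (Fin n) K)}

/-- The variable `x_j` is a nonzerodivisor modulo the monomial ideal `I`. -/
def IsVarSaturated (I : Ideal (MvPolynomial (Fin n) K)) (j : Fin n) : Prop :=
  ∀ d, d + Finsupp.single j 1 ∈ idealExponents I → d ∈ idealExponents I

lemma ofList_map_X (l : List (Fin n)) :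
    Ideal.ofList (l.map (X : Fin n → MvPolynomial (Fin n) K)) = Ideal.span (X '' {j | j ∈ l}) := by
  rw [Ideal.ofList]
  congr 1
  ext f
  simp

/-- Regularity of a variable modulo a monomial ideal can be tested on monomials. -/
lemma IsMonomialIdeal.mem_of_X_mul_mem (hI : IsMonomialIdeal I) {j : Fin n}
    {f : MvPolynomial (Fin n) K}
    (h : ∀ d ∈ f.support, d + Finsupp.single j 1 ∈ idealExponents I → d ∈ idealExponents I)
    (hf : X j * f ∈ I) : f ∈ I := by
  rw [hI.mem_iff] at hf ⊢
  refine fun d hd => h d hd (hf _ ?_)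
  rw [mem_support_iff, add_comm, coeff_X_mul]
  exact mem_support_iff.1 hd

lemma X_mul_monomial_one (j : Fin n) (d : Fin n →₀ ℕ) :
    (X j * monomial d 1 : MvPolynomial (Fin n) K) = monomial (d + Finsupp.single j 1) 1 := by
  rw [X, monomial_mul, mul_one, add_comm]

lemma mem_ofList_smul_top_quotient_iff (l : List (Fin n)) {f : MvPolynomial (Fin n) K} :
    (Submodule.Quotient.mk f : MvPolynomial (Fin n) K ⧸ I) ∈
      Ideal.ofList (l.map (X : Fin n → MvPolynomial (Fin n) K)) •
      (⊤ : Submodule (MvPolynomial (Fin n) K) (MvPolynomial (Fin n) K ⧸ I)) ↔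
      f ∈ Ideal.span (X '' {j | j ∈ l}) ⊔ I := by
  have := Submodule.comap_smul_top_of_surjective
    (Ideal.ofList (l.map (X : Fin n → MvPolynomial (Fin n) K))) I.mkQ (Submodule.mkQ_surjective _)
  rw [Submodule.ker_mkQ, ofList_map_X, smul_eq_mul, Ideal.mul_top] at this
  rw [← this, ofList_map_X]
  rfl

lemma mem_ofList_smul_top_ideal_iff (l : List (Fin n)) {f : I} :
    f ∈ Ideal.ofList (l.map (X : Fin n → MvPolynomial (Fin n) K)) •
      (⊤ : Submodule (MvPolynomial (Fin n) K) I) ↔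
      (f : MvPolynomial (Fin n) K) ∈ Ideal.span (X '' {j | j ∈ l}) * I := by
  rw [← Submodule.comap_map_eq_of_injective (Submodule.injective_subtype I)
    (Ideal.ofList (l.map (X : Fin n → MvPolynomial (Fin n) K)) • ⊤), Submodule.map_smul'',
    Submodule.map_top, Submodule.range_subtype, ofList_map_X]
  rfl

/-- A new variable is a nonzerodivisor modulo the earlier ones and modulo I, and for monomials
membership in the sum is membership in one of the two. -/
lemma IsMonomialIdeal.isWeaklyRegular_quotient (hI : IsMonomialIdeal I) {l : List (Fin n)}
    (hl : l.Nodup) (hsat : ∀ j ∈ l, IsVarSaturated I j) :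
    IsWeaklyRegular (MvPolynomial (Fin n) K ⧸ I) (l.map (X : Fin n → MvPolynomial (Fin n) K)) := by
  refine ⟨fun i hi => ?_⟩
  rw [isSMulRegular_quotient_iff_mem_of_smul_mem]
  intro g hg
  obtain ⟨f, rfl⟩ := Submodule.Quotient.mk_surjective _ g
  rw [← Submodule.Quotient.mk_smul, ← List.map_take] at hg
  rw [mem_ofList_smul_top_quotient_iff] at hg
  rw [← List.map_take, mem_ofList_smul_top_quotient_iff]
  simp only [List.getElem_map, smul_eq_mul] at hg
  have hS := isMonomialIdeal_span_X_image (K := K) {j | j ∈ l.take i}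
  refine (hS.sup hI).mem_of_X_mul_mem (fun d _ hd => ?_) hg
  rw [hS.mem_idealExponents_sup hI, mem_idealExponents_span_X_image] at hd ⊢
  refine hd.imp (fun ⟨m, hm, h⟩ => ⟨m, hm, ?_⟩) (hsat _ (List.getElem_mem _) d)
  have hne : l[i]'(by simpa using hi) ≠ m := by
    rintro rfl
    obtain ⟨k, hk, h'⟩ := List.mem_take_iff_getElem.1 hm
    have := (hl.getElem_inj_iff).1 h'
    omega
  simpa [hne] using h

/-- If x_j x^d = x_m a with a ∈ I and m ≠ j earlier, then x_m divides x^d, and saturation in x_m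
puts x^d / x_m into I. Saturation is needed only for the earlier variables, so an arbitrary z may
come last. -/
lemma IsMonomialIdeal.isWeaklyRegular_ideal (hI : IsMonomialIdeal I) {l : List (Fin n)}
    {z : Fin n} (hl : (l ++ [z]).Nodup) (hsat : ∀ j ∈ l, IsVarSaturated I j) :
    IsWeaklyRegular I ((l ++ [z]).map (X : Fin n → MvPolynomial (Fin n) K)) := by
  refine ⟨fun i hi => ?_⟩
  have hi' : i < (l ++ [z]).length := by simpa using hi
  rw [isSMulRegular_quotient_iff_mem_of_smul_mem]
  intro f hf
  rw [← List.map_take, mem_ofList_smul_top_ideal_iff] at hf ⊢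
  simp only [List.getElem_map, Submodule.coe_smul, smul_eq_mul] at hf
  have hS := isMonomialIdeal_span_X_image (K := K) {j | j ∈ (l ++ [z]).take i}
  refine (hS.mul hI).mem_of_X_mul_mem (fun d hdf hd => ?_) hf
  have hdI := hI.mem_iff.1 f.2 d hdf
  rw [mem_idealExponents_span_X_image_mul hI] at hd ⊢
  obtain ⟨m, hm, a, ha, h⟩ := hd
  have hne : (l ++ [z])[i] ≠ m := by
    intro h''
    obtain ⟨k, hk, h'⟩ := List.mem_take_iff_getElem.1 hm
    have := (hl.getElem_inj_iff).1 (h'.trans h''.symm)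
    omega
  have hml : m ∈ l := by
    have hm' : m ∈ (l ++ [z]).take i := hm
    rw [List.take_append_of_le_length (by simp at hi'; omega)] at hm'
    exact List.mem_of_mem_take hm'
  have hdm : 0 < d m := by
    have := DFunLike.congr_fun h m
    simp only [Finsupp.add_apply, Finsupp.single_eq_same,
      Finsupp.single_eq_of_ne hne.symm] at this
    omega
  have hle : Finsupp.single m 1 ≤ d := Finsupp.single_le_iff.2 hdm
  exact ⟨m, hm, d - Finsupp.single m 1, hsat m hml _ (by rwa [tsub_add_cancel_of_le hle]),
    add_tsub_cancel_of_le hle⟩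

end VariableSequences

/-! ### Ideals saturated in the last variables, with a socle monomial -/

section SaturatedIdeals

universe u

variable {K : Type u} [Field K] {n p : ℕ} {I J : Ideal (MvPolynomial (Fin n) K)}

lemma card_filter_val_ge (n p : ℕ) :
    (Finset.univ.filter fun j : Fin n => p ≤ (j : ℕ)).card = n - p := by
  have h1 := Finset.card_filter_add_card_filter_not (s := (Finset.univ : Finset (Fin n)))
    fun j => (j : ℕ) < p
  simp only [not_lt, Fin.card_filter_val_lt, Finset.card_univ, Fintype.card_fin] at h1
  omega

lemma filter_mem_idealExponents_iff (hsat : ∀ j : Fin n, p ≤ (j : ℕ) → IsVarSaturated J j)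
    {d : Fin n →₀ ℕ} :
    d.filter (fun j : Fin n => (j : ℕ) < p) ∈ idealExponents J ↔ d ∈ idealExponents J := by
  have h1 : ∀ j : Fin n, p ≤ (j : ℕ) → ∀ (m : ℕ) d,
      d + Finsupp.single j m ∈ idealExponents J → d ∈ idealExponents J := by
    intro j hj m
    induction m with
    | zero => simp
    | succ m ih =>
      intro d hd
      rw [Finsupp.single_add, ← add_assoc] at hd
      exact ih d (hsat j hj _ hd)
  have h2 : ∀ e : Fin n →₀ ℕ, (∀ j : Fin n, (j : ℕ) < p → e j = 0) →
      ∀ d, d + e ∈ idealExponents J → d ∈ idealExponents J := by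
    intro e
    induction e using Finsupp.induction with
    | zero => simp
    | single_add a m f ha hm ih =>
      intro he d hd
      refine ih (fun j hj => ?_) d (h1 a ?_ m _ (by rwa [add_right_comm, add_assoc]))
      · have := he j hj
        simp only [Finsupp.add_apply] at this
        omega
      · by_contra hlt
        have := he a (by omega)
        simp only [Finsupp.add_apply, Finsupp.single_eq_same] at this
        omega
  refine ⟨fun h => isUpperSet_idealExponents (fun j => ?_) h, fun h => ?_⟩
  · rw [Finsupp.filter_apply]; split_ifs <;> simp
  · refine h2 (d.filter fun j : Fin n => ¬ (j : ℕ) < p) (fun j hj => by simp [hj]) _ ?_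
    rwa [Finsupp.filter_add_filter_not]

lemma IsMonomialIdeal.exists_finset (hJ : IsMonomialIdeal J) :
    ∃ G : Finset (Fin n →₀ ℕ), ∀ d, d ∈ idealExponents J ↔ ∃ g ∈ G, g ≤ d := by
  classical
  obtain ⟨s, hs⟩ := (inferInstance : IsNoetherianRing (MvPolynomial (Fin n) K)).noetherian J
  refine ⟨s.biUnion support, fun d => ⟨fun hd => ?_, fun ⟨g, hg, hgd⟩ => ?_⟩⟩
  · have hle : J ≤ Ideal.span ((fun d => monomial d (1 : K)) '' (s.biUnion support : Finset _)) := by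
      rw [← hs]
      refine Submodule.span_le.2 fun f hf => mem_ideal_span_monomial_image.2 fun e he => ?_
      exact ⟨e, Finset.mem_coe.2 (Finset.mem_biUnion.2 ⟨f, hf, he⟩), le_rfl⟩
    simpa using mem_idealExponents_span_iff.1 (hle hd)
  · obtain ⟨f, hf, hgf⟩ := Finset.mem_biUnion.1 hg
    refine isUpperSet_idealExponents hgd (hJ.mem_iff.1 ?_ g hgf)
    rw [← hs]
    exact Submodule.subset_span hf

lemma IsMonomialIdeal.exists_trunc (hJ : IsMonomialIdeal J)
    (hsat : ∀ j : Fin n, p ≤ (j : ℕ) → IsVarSaturated J j) (z : Fin n) (hz : (z : ℕ) < p) :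
    ∃ N : Fin n →₀ ℕ, (∀ d, d ⊓ N ∈ idealExponents J ↔ d ∈ idealExponents J) ∧ N z ≠ 0 ∧
      n - p ≤ (Finset.univ.filter fun j => N j = 0).card := by
  classical
  obtain ⟨G, hG⟩ := hJ.exists_finset
  -- The cap is the lcm of the generators restricted to the first p variables; joining x_z ensures N
  -- z ≠ 0 without losing any zero of N beyond p.
  refine ⟨(G.sup id).filter (fun j : Fin n => (j : ℕ) < p) ⊔ Finsupp.single z 1, fun d =>
    ⟨fun h => isUpperSet_idealExponents inf_le_left h, fun h => ?_⟩, ?_, ?_⟩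
  · obtain ⟨g, hg, hgd⟩ := (hG _).1 ((filter_mem_idealExponents_iff hsat).2 h)
    refine (hG _).2 ⟨g, hg, fun j => ?_⟩
    have h1 := hgd j
    have h2 : g j ≤ G.sup id j := (Finset.le_sup (f := id) hg : g ≤ G.sup id) j
    rw [Finsupp.filter_apply] at h1
    rw [Finsupp.inf_apply, Finsupp.sup_apply, Finsupp.filter_apply]
    split_ifs at h1 ⊢
    · exact le_inf h1 (h2.trans le_sup_left)
    · omega
  · simp
  · rw [← card_filter_val_ge]
    refine Finset.card_le_card fun j hj => ?_
    simp only [Finset.mem_filter, Finset.mem_univ, true_and] at hj ⊢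
    have : z ≠ j := by rintro rfl; omega
    simp [not_lt.2 hj, this]

/-- The exponent `w` of a monomial in the first `p` variables which represents a generator of the
socle of `K[x_1, …, x_p]` modulo `J`. -/
structure IsSocleExponent (J : Ideal (MvPolynomial (Fin n) K)) (p : ℕ) (w : Fin n →₀ ℕ) :
    Prop where
  notMem : w ∉ idealExponents J
  add_single_mem : ∀ j : Fin n, (j : ℕ) < p → w + Finsupp.single j 1 ∈ idealExponents J
  eq_zero : ∀ j : Fin n, p ≤ (j : ℕ) → w j = 0

lemma IsSocleExponent.of_filter (hsat : ∀ j : Fin n, p ≤ (j : ℕ) → IsVarSaturated J j)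
    {w : Fin n →₀ ℕ} (hw : w ∉ idealExponents J)
    (hw' : ∀ j : Fin n, (j : ℕ) < p → w + Finsupp.single j 1 ∈ idealExponents J) :
    IsSocleExponent J p (w.filter fun j : Fin n => (j : ℕ) < p) where
  notMem := by rwa [filter_mem_idealExponents_iff hsat]
  add_single_mem j hj := by
    have := (filter_mem_idealExponents_iff hsat).2 (hw' j hj)
    rwa [Finsupp.filter_add, Finsupp.filter_single_of_pos (fun j : Fin n => (j : ℕ) < p) hj] at this
  eq_zero j hj := by simp [not_lt.2 hj]

lemma sdepthQuot_eq (hJ : IsMonomialIdeal J) (hp : p ≤ n) (hp0 : 0 < p)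
    (hsat : ∀ j : Fin n, p ≤ (j : ℕ) → IsVarSaturated J j) {w : Fin n →₀ ℕ}
    (hw : IsSocleExponent J p w) : sdepthQuot J = ((n - p : ℕ) : ℕ∞) := by
  obtain ⟨N, hN, -, hcard⟩ := hJ.exists_trunc hsat ⟨0, by omega⟩ hp0
  refine le_antisymm (hJ.isMonomialBasis_quotBasis.sdepth_le fun k hk => ?_)
    (hJ.isMonomialBasis_quotBasis.le_sdepth (.of_trunc N (fun d => not_congr (hN d)) hcard))
  have := hk.le_of_corner hw.notMem (Finset.univ.filter fun j : Fin n => (j : ℕ) < p) fun j hj =>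
    not_not.2 (hw.add_single_mem j (by simpa using hj))
  rwa [Fin.card_filter_val_lt, min_eq_right hp] at this

lemma le_sdepthIdeal (hJ : IsMonomialIdeal J) (hp : p ≤ n) (hp0 : 0 < p)
    (hsat : ∀ j : Fin n, p ≤ (j : ℕ) → IsVarSaturated J j) :
    ((n - p + 1 : ℕ) : ℕ∞) ≤ sdepthIdeal J := by
  obtain ⟨N, hN, hz, hcard⟩ := hJ.exists_trunc hsat ⟨0, by omega⟩ hp0
  exact hJ.isMonomialBasis_basis.le_sdepth
    (.of_trunc_of_isUpperSet N hN isUpperSet_idealExponents _ hz (by omega))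

/-- Passing to the colon ideal by a monomial does not decrease the Stanley depth. -/
lemma sdepthIdeal_le_of_colon (hI : IsMonomialIdeal I) (hJ : IsMonomialIdeal J)
    (u : Fin n →₀ ℕ) (hu : ∀ d, d ∈ idealExponents J ↔ d + u ∈ idealExponents I) :
    sdepthIdeal I ≤ sdepthIdeal J := by
  refine hI.isMonomialBasis_basis.sdepth_le_sdepth hJ.isMonomialBasis_basis fun k hk => ?_
  rw [show idealExponents J = {d | d + u ∈ idealExponents I} from Set.ext hu]
  exact hk.shift u

lemma isMonomialIdeal_initialVarIdeal : IsMonomialIdeal (initialVarIdeal K n p) :=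
  isMonomialIdeal_span_X_image _

/-- The socle condition together with saturation says that (J : x^w) = (x_1, …, x_p). -/
lemma sdepthIdeal_le_initialVarIdeal (hJ : IsMonomialIdeal J)
    (hsat : ∀ j : Fin n, p ≤ (j : ℕ) → IsVarSaturated J j) {w : Fin n →₀ ℕ}
    (hw : IsSocleExponent J p w) : sdepthIdeal J ≤ sdepthIdeal (initialVarIdeal K n p) := by
  refine sdepthIdeal_le_of_colon hJ isMonomialIdeal_initialVarIdeal w fun d => ?_
  rw [initialVarIdeal_exponents]
  constructor
  · rintro ⟨j, hj, hd⟩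
    refine isUpperSet_idealExponents ?_ (hw.add_single_mem j hj)
    rw [add_comm]
    gcongr
    exact Finsupp.single_le_iff.2 hd
  · intro h
    by_contra hd
    have hd' : ∀ j : Fin n, (j : ℕ) < p → d j = 0 := fun j hj => by
      by_contra h0
      exact hd ⟨j, hj, Nat.pos_of_ne_zero h0⟩
    refine hw.notMem (isUpperSet_idealExponents (fun j => ?_)
      ((filter_mem_idealExponents_iff hsat).2 h))
    rw [Finsupp.filter_apply, Finsupp.add_apply]
    split_ifs with hj
    · simp [hd' j hj]
    · exact Nat.zero_le _

lemma sdepthIdeal_initialVarIdeal (hp : p ≤ n) (hp0 : 0 < p) :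
    sdepthIdeal (initialVarIdeal K n p) = ((n - p / 2 : ℕ) : ℕ∞) := by
  have hb := (isMonomialIdeal_initialVarIdeal (K := K) (n := n) (p := p)).isMonomialBasis_basis
  refine le_antisymm (hb.sdepth_le fun k hk => ?_) (hb.le_sdepth ?_)
  · rw [initialVarIdeal_exponents] at hk
    exact hk.le_of_initialVarExponents hp hp0
  · rw [initialVarIdeal_exponents]
    exact hasBoxPartition_initialVarExponents hp

/-- The indices of the variables `x_{p+1}, …, x_n`. -/
def finalIndices (n p : ℕ) : List (Fin n) :=
  (List.finRange n).filter fun j => p ≤ (j : ℕ)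

lemma mem_finalIndices {j : Fin n} : j ∈ finalIndices n p ↔ p ≤ (j : ℕ) := by
  simp [finalIndices]

lemma nodup_finalIndices (n p : ℕ) : (finalIndices n p).Nodup :=
  (List.nodup_finRange n).filter _

lemma length_finalIndices (n p : ℕ) : (finalIndices n p).length = n - p := by
  rw [← List.toFinset_card_of_nodup (nodup_finalIndices n p), ← card_filter_val_ge]
  congr 1
  ext j
  simp [mem_finalIndices]

lemma X_mem_idealOfVars {l : List (Fin n)} {r : MvPolynomial (Fin n) K} (hr : r ∈ l.map X) :
    r ∈ idealOfVars (Fin n) K := by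
  obtain ⟨j, -, rfl⟩ := List.mem_map.1 hr
  exact Ideal.subset_span ⟨j, rfl⟩

lemma depthQuot_eq (hJ : IsMonomialIdeal J)
    (hsat : ∀ j : Fin n, p ≤ (j : ℕ) → IsVarSaturated J j) {w : Fin n →₀ ℕ}
    (hw : IsSocleExponent J p w) : depthQuot J = ((n - p : ℕ) : ℕ∞) := by
  have hS := isMonomialIdeal_span_X_image (K := K) {j | j ∈ finalIndices n p}
  rw [depthQuot, polyDepth_eq_length ((finalIndices n p).map X) (fun r => X_mem_idealOfVars)
    (hJ.isWeaklyRegular_quotient (nodup_finalIndices n p) fun j hj => hsat j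
      (mem_finalIndices.1 hj)) (Submodule.Quotient.mk (monomial w 1)), List.length_map,
    length_finalIndices]
  · rw [mem_ofList_smul_top_quotient_iff, ← mem_idealExponents, hS.mem_idealExponents_sup hJ,
      mem_idealExponents_span_X_image]
    rintro (⟨j, hj, h⟩ | h)
    · exact h.ne' (hw.eq_zero j (mem_finalIndices.1 hj))
    · exact hw.notMem h
  · intro j
    rw [← Submodule.Quotient.mk_smul, mem_ofList_smul_top_quotient_iff, smul_eq_mul,
      X_mul_monomial_one, ← mem_idealExponents, hS.mem_idealExponents_sup hJ,
      mem_idealExponents_span_X_image]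
    by_cases hj : (j : ℕ) < p
    · exact Or.inr (hw.add_single_mem j hj)
    · exact Or.inl ⟨j, mem_finalIndices.2 (not_lt.1 hj), by simp⟩

/-- The socle element is x_1 x^w: for j ≤ p one has x_j (x_1 x^w) = x_1 (x_j x^w) ∈ x_1 J, while x_1
x^w ∈ x_1 J would force x^w ∈ J. -/
lemma depthIdeal_eq (hJ : IsMonomialIdeal J) (hp : p ≤ n) (hp0 : 0 < p)
    (hsat : ∀ j : Fin n, p ≤ (j : ℕ) → IsVarSaturated J j) {w : Fin n →₀ ℕ}
    (hw : IsSocleExponent J p w) : depthIdeal J = ((n - p + 1 : ℕ) : ℕ∞) := by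
  let z : Fin n := ⟨0, by omega⟩
  have hzl : z ∉ finalIndices n p := fun h => (mem_finalIndices.1 h).not_gt hp0
  have hnd : (finalIndices n p ++ [z]).Nodup :=
    List.nodup_append_comm.1 (List.nodup_cons.2 ⟨hzl, nodup_finalIndices n p⟩)
  rw [depthIdeal, polyDepth_eq_length ((finalIndices n p ++ [z]).map X)
    (fun r => X_mem_idealOfVars) (hJ.isWeaklyRegular_ideal hnd fun j hj => hsat j
      (mem_finalIndices.1 hj)) ⟨monomial (w + Finsupp.single z 1) 1, hw.add_single_mem z hp0⟩,
    List.length_map, List.length_append, length_finalIndices, List.length_singleton]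
  · rw [mem_ofList_smul_top_ideal_iff, ← mem_idealExponents,
      mem_idealExponents_span_X_image_mul hJ]
    rintro ⟨j, hj, a, ha, h⟩
    rcases List.mem_append.1 hj with hj | hj
    · have h1 := DFunLike.congr_fun h j
      have h2 := hw.eq_zero j (mem_finalIndices.1 hj)
      have h3 : z ≠ j := fun h => hzl (h ▸ hj)
      simp [h2, h3] at h1
    · rw [List.mem_singleton.1 hj, add_comm, add_left_inj] at h
      exact hw.notMem (h ▸ ha)
  · intro j
    rw [mem_ofList_smul_top_ideal_iff, Submodule.coe_smul, smul_eq_mul, X_mul_monomial_one,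
      ← mem_idealExponents, mem_idealExponents_span_X_image_mul hJ]
    by_cases hj : (j : ℕ) < p
    · exact ⟨z, by simp, _, hw.add_single_mem j hj, by abel⟩
    · refine ⟨j, ?_, _, hw.add_single_mem z hp0, by abel⟩
      exact List.mem_append_left _ (mem_finalIndices.2 (not_lt.1 hj))

end SaturatedIdeals

/-! ### The sequential chain -/

section TailIntersections

variable {K : Type*} [Field K] {n m : ℕ} {I : Ideal (MvPolynomial (Fin n) K)}
  {ν : Fin (m + 1) → ℕ} {Q : Fin (m + 1) → Ideal (MvPolynomial (Fin n) K)}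

lemma mem_tailInter_iff {R : Type*} [CommRing R] {Q : Fin (m + 1) → Ideal R} {k : Fin (m + 1)}
    {f : R} : f ∈ tailInter Q k ↔ ∀ j, k ≤ j → f ∈ Q j := by
  simp only [tailInter, Submodule.mem_iInf]

lemma X_mem_initialVarIdeal_iff {j : Fin n} {p : ℕ} :
    X j ∈ initialVarIdeal K n p ↔ (j : ℕ) < p := by
  rw [initialVarIdeal, mem_ideal_span_X_image, support_X]
  simp [Finsupp.single_apply]

lemma IsReducedPrimaryDecomposition.tailInter_zero (hQ : IsReducedPrimaryDecomposition I Q) :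
    tailInter Q 0 = I := by
  rw [← hQ.2.inf_eq]
  ext f
  simp [mem_tailInter_iff]

lemma IsReducedPrimaryDecomposition.isPrimary (hQ : IsReducedPrimaryDecomposition I Q)
    (i : Fin (m + 1)) : (Q i).IsPrimary :=
  hQ.2.primary (by simp)

lemma IsReducedPrimaryDecomposition.mem_of_mul_mem (hQ : IsReducedPrimaryDecomposition I Q)
    {i : Fin (m + 1)} {g f : MvPolynomial (Fin n) K} (hg : g ∉ (Q i).radical)
    (h : g * f ∈ Q i) : f ∈ Q i :=
  ((Ideal.isPrimary_iff.1 (hQ.isPrimary i)).2 (mul_comm g f ▸ h)).resolve_right hg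

lemma IsReducedPrimaryDecomposition.isPrime_initialVarIdeal
    (hQ : IsReducedPrimaryDecomposition I Q)
    (hrad : ∀ i, (Q i).radical = initialVarIdeal K n (ν i)) (i : Fin (m + 1)) :
    (initialVarIdeal K n (ν i)).IsPrime :=
  hrad i ▸ Ideal.isPrime_radical (hQ.isPrimary i)

lemma IsReducedPrimaryDecomposition.isVarSaturated_tailInter
    (hQ : IsReducedPrimaryDecomposition I Q) (hν : StrictAnti ν)
    (hrad : ∀ i, (Q i).radical = initialVarIdeal K n (ν i)) (k : Fin (m + 1)) (j : Fin n)
    (hj : ν k ≤ (j : ℕ)) : IsVarSaturated (tailInter Q k) j := by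
  intro d hd
  rw [mem_idealExponents, ← X_mul_monomial_one, mem_tailInter_iff] at hd
  rw [mem_idealExponents, mem_tailInter_iff]
  refine fun l hl => hQ.mem_of_mul_mem ?_ (hd l hl)
  rw [hrad, X_mem_initialVarIdeal_iff]
  have := hν.antitone hl
  omega

/-- A later term of the sequential chain is the colon ideal of an earlier one by a monomial. -/
lemma IsReducedPrimaryDecomposition.exists_tailInter_eq_colon
    (hQ : IsReducedPrimaryDecomposition I Q) (hν : StrictAnti ν) (hν_le : ν 0 ≤ n)
    (hν_pos : 1 ≤ ν (Fin.last m)) (hrad : ∀ i, (Q i).radical = initialVarIdeal K n (ν i))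
    {i j : Fin (m + 1)} (hij : i ≤ j) : ∃ u : Fin n →₀ ℕ,
      monomial u (1 : K) ∉ initialVarIdeal K n (ν j) ∧
      ∀ f, f ∈ tailInter Q j ↔ monomial u 1 * f ∈ tailInter Q i := by
  have hprime := hQ.isPrime_initialVarIdeal hrad j
  rcases hij.eq_or_lt with rfl | hlt
  · refine ⟨0, fun h => hprime.ne_top ((Ideal.eq_top_iff_one _).2 h), fun f => ?_⟩
    rw [show monomial (0 : Fin n →₀ ℕ) (1 : K) = 1 from rfl, one_mul]
  · let i' : Fin (m + 1) := ⟨j - 1, by omega⟩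
    have hi'j : i' < j := by
      rw [Fin.lt_def] at hlt ⊢
      simp only [i']
      omega
    have hpos : 1 ≤ ν i' := hν_pos.trans (hν.antitone (Fin.le_last _))
    have hle : ν i' ≤ n := (hν.antitone (Fin.zero_le _)).trans hν_le
    -- This is the last variable of P_{j-1}. It lies in P_l for every l < j and in no P_l with l ≥
    -- j, so a high power of it removes exactly the components before j.
    let t : Fin n := ⟨ν i' - 1, by omega⟩
    have hnot : ∀ l, j ≤ l → X t ∉ initialVarIdeal K n (ν l) := by
      intro l hl
      rw [X_mem_initialVarIdeal_iff]
      have := hν (hi'j.trans_le hl)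
      simp only [t]
      omega
    have hex : ∀ l, ∃ N : ℕ, l < j → (X t : MvPolynomial (Fin n) K) ^ N ∈ Q l := by
      intro l
      by_cases hl : l < j
      · have hl' : l ≤ i' := by
          rw [Fin.lt_def] at hl
          rw [Fin.le_def]
          simp only [i']
          omega
        have : X t ∈ (Q l).radical := by
          rw [hrad, X_mem_initialVarIdeal_iff]
          have := hν.antitone hl'
          simp only [t]
          omega
        obtain ⟨N, hN⟩ := this
        exact ⟨N, fun _ => hN⟩
      · exact ⟨0, fun h => absurd h hl⟩
    choose N hN using hex
    have hpow : monomial (Finsupp.single t (Finset.univ.sup N)) (1 : K) =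
        X t ^ Finset.univ.sup N := by rw [X_pow_eq_monomial]
    refine ⟨Finsupp.single t (Finset.univ.sup N), ?_, fun f => ?_⟩
    · rw [hpow]
      exact fun h => hnot j le_rfl (hprime.mem_of_pow_mem _ h)
    · rw [hpow, mem_tailInter_iff, mem_tailInter_iff]
      refine ⟨fun h l _ => ?_, fun h l hl => hQ.mem_of_mul_mem ?_ (h l (hij.trans hl))⟩
      · by_cases hl : l < j
        · exact Ideal.mul_mem_right _ _ ((Q l).mem_of_dvd (pow_dvd_pow _
            (Finset.le_sup (Finset.mem_univ l))) (hN l hl))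
        · exact Ideal.mul_mem_left _ _ (h l (not_lt.1 hl))
      · rw [hrad]
        exact fun h' => hnot l hl
          ((hQ.isPrime_initialVarIdeal hrad l).mem_of_pow_mem _ h')

lemma IsMonomialIdeal.of_colon {J : Ideal (MvPolynomial (Fin n) K)} (hI : IsMonomialIdeal I)
    {u : Fin n →₀ ℕ} (hu : ∀ f, f ∈ J ↔ monomial u 1 * f ∈ I) : IsMonomialIdeal J := by
  refine isMonomialIdeal_of_mem fun f hf d hd => ?_
  rw [mem_idealExponents, hu, monomial_mul, mul_one]
  refine hI.mem_iff.1 ((hu f).1 hf) _ ?_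
  rw [mem_support_iff, coeff_monomial_mul, one_mul]
  exact mem_support_iff.1 hd

lemma IsReducedPrimaryDecomposition.isMonomialIdeal_tailInter
    (hQ : IsReducedPrimaryDecomposition I Q) (hI : IsMonomialIdeal I) (hν : StrictAnti ν)
    (hν_le : ν 0 ≤ n) (hν_pos : 1 ≤ ν (Fin.last m))
    (hrad : ∀ i, (Q i).radical = initialVarIdeal K n (ν i)) (k : Fin (m + 1)) :
    IsMonomialIdeal (tailInter Q k) := by
  obtain ⟨u, -, hu⟩ := hQ.exists_tailInter_eq_colon hν hν_le hν_pos hrad (Fin.zero_le k)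
  rw [hQ.tailInter_zero] at hu
  exact hI.of_colon hu

/-- Write P_k = (I : f) and I_k = (I : x^u) with x^u ∉ P_k. Then f ∉ I_k, as otherwise x^u f ∈ I.
Some monomial of f lies outside I_k, yet x_j f ∈ I ⊂ I_k for x_j ∈ P_k, so P_k multiplies that
monomial into I_k; its later variables are dropped by saturation. -/
lemma IsReducedPrimaryDecomposition.exists_isSocleExponent_tailInter
    (hQ : IsReducedPrimaryDecomposition I Q) (hI : IsMonomialIdeal I) (hν : StrictAnti ν)
    (hν_le : ν 0 ≤ n) (hν_pos : 1 ≤ ν (Fin.last m))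
    (hAss : associatedPrimes (MvPolynomial (Fin n) K) (MvPolynomial (Fin n) K ⧸ I) =
      Set.range fun i => initialVarIdeal K n (ν i))
    (hrad : ∀ i, (Q i).radical = initialVarIdeal K n (ν i)) (k : Fin (m + 1)) :
    ∃ w, IsSocleExponent (tailInter Q k) (ν k) w := by
  have hJ := hQ.isMonomialIdeal_tailInter hI hν hν_le hν_pos hrad k
  obtain ⟨u, hu, huk⟩ := hQ.exists_tailInter_eq_colon hν hν_le hν_pos hrad (Fin.zero_le k)
  rw [hQ.tailInter_zero] at huk
  have hmem : initialVarIdeal K n (ν k) ∈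
      associatedPrimes (MvPolynomial (Fin n) K) (MvPolynomial (Fin n) K ⧸ I) :=
    hAss ▸ Set.mem_range_self k
  obtain ⟨-, x, hx⟩ := isAssociatedPrime_iff.1 (AssociatedPrimes.mem_iff.1 hmem)
  obtain ⟨f, rfl⟩ := Submodule.Quotient.mk_surjective _ x
  have hcolon : ∀ g, g ∈ initialVarIdeal K n (ν k) ↔ g * f ∈ I := by
    intro g
    rw [hx, Submodule.mem_colon_singleton, Submodule.mem_bot, ← Submodule.Quotient.mk_smul,
      Submodule.Quotient.mk_eq_zero, smul_eq_mul]
  have hf : f ∉ tailInter Q k := fun h => hu ((hcolon _).2 ((huk f).1 h))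
  rw [hJ.mem_iff] at hf
  push Not at hf
  obtain ⟨w, hw, hwJ⟩ := hf
  refine ⟨_, IsSocleExponent.of_filter (hQ.isVarSaturated_tailInter hν hrad k) hwJ
    fun j hj => ?_⟩
  have h1 : X j * f ∈ tailInter Q k := by
    rw [huk]
    exact I.mul_mem_left _ ((hcolon _).1 (X_mem_initialVarIdeal_iff.2 hj))
  refine hJ.mem_iff.1 h1 _ ?_
  rw [mem_support_iff, add_comm, coeff_X_mul]
  exact mem_support_iff.1 hw

end TailIntersections
end

theorem proposition1p2 {K : Type*} [Field K] {n m : ℕ}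
    (I : Ideal (MvPolynomial (Fin n) K)) (hI : IsBorelType I)
    (ν : Fin (m + 1) → ℕ) (hν : StrictAnti ν) (hν_le : ν 0 ≤ n) (hν_pos : 1 ≤ ν (Fin.last m))
    (hAss : associatedPrimes (MvPolynomial (Fin n) K) (MvPolynomial (Fin n) K ⧸ I) =
      Set.range fun i => initialVarIdeal K n (ν i))
    (Q : Fin (m + 1) → Ideal (MvPolynomial (Fin n) K))
    (hQ : IsReducedPrimaryDecomposition I Q)
    (hrad : ∀ i, (Q i).radical = initialVarIdeal K n (ν i)) :
    (∀ i, sdepthQuot (tailInter Q i) = depthQuot (tailInter Q i) ∧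
      depthQuot (tailInter Q i) = ((n - ν i : ℕ) : ℕ∞)) ∧
    (∀ i j, i ≤ j → sdepthIdeal (tailInter Q i) ≤ sdepthIdeal (tailInter Q j)) ∧
    (∀ i, depthIdeal (tailInter Q i) = ((n - ν i + 1 : ℕ) : ℕ∞) ∧
      ((n - ν i + 1 : ℕ) : ℕ∞) ≤ sdepthIdeal (tailInter Q i) ∧
      sdepthIdeal (tailInter Q i) ≤ sdepthIdeal (initialVarIdeal K n (ν i)) ∧
      sdepthIdeal (initialVarIdeal K n (ν i)) = ((n - ν i / 2 : ℕ) : ℕ∞)) := by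
  have hmon := hQ.isMonomialIdeal_tailInter hI.1 hν hν_le hν_pos hrad
  have hsat := hQ.isVarSaturated_tailInter hν hrad
  choose w hw using hQ.exists_isSocleExponent_tailInter hI.1 hν hν_le hν_pos hAss hrad
  have hle : ∀ i, ν i ≤ n := fun i => (hν.antitone (Fin.zero_le i)).trans hν_le
  have hpos : ∀ i, 0 < ν i := fun i => hν_pos.trans (hν.antitone (Fin.le_last i))
  refine ⟨fun i => ?_, fun i j hij => ?_, fun i => ⟨?_, ?_, ?_, ?_⟩⟩
  · have hdepth := depthQuot_eq (hmon i) (hsat i) (hw i)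
    exact ⟨(sdepthQuot_eq (hmon i) (hle i) (hpos i) (hsat i) (hw i)).trans hdepth.symm, hdepth⟩
  · obtain ⟨u, -, hu⟩ := hQ.exists_tailInter_eq_colon hν hν_le hν_pos hrad hij
    refine sdepthIdeal_le_of_colon (hmon i) (hmon j) u fun d => ?_
    rw [mem_idealExponents, hu, monomial_mul, mul_one, add_comm, mem_idealExponents]
  · exact depthIdeal_eq (hmon i) (hle i) (hpos i) (hsat i) (hw i)
  · exact le_sdepthIdeal (hmon i) (hle i) (hpos i) (hsat i)
  · exact sdepthIdeal_le_initialVarIdeal (hmon i) (hsat i) (hw i)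
  · exact sdepthIdeal_initialVarIdeal (hle i) (hpos i)
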